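/- Fix $n\ge 1$ and an even function $\chi\in C^\infty_0(\mathbb R)$ with $0\le\chi\le1$, $\chi(t)=1$ for $|t|\le 11/10$ and $\chi(t)=0$ for $|t|\ge 19/10$. For $k\ge 0$ put $\chi_k(\xi)=\chi(2^{-k}|\xi|)$, $\xi\in\mathbb R^n$, and let $S_k u=\chi_k(D)u=\tilde\chi_k*u$, where $D=-i\partial_x$ and $\tilde\chi_k$ is the inverse Fourier transform of $\chi_k$; put also $S_{-1}=0$ and $\Delta_k=S_k-S_{k-1}$ for $k\ge0$. Let $\mathrm{Lip}$ be the space of bounded Lipschitz continuous functions $a:\mathbb R^n\to\mathbb C$, with $\|a\|_{\mathrm{Lip}}=\|a\|_{L^\infty}+\|\nabla a\|_{L^\infty}$. For $m\in\mathbb N=\{0,1,2,\dots\}$ and $a\in\mathrm{Lip}$ the modified paraproduct is $$T^m_a w=(S_{m-1}a)\,S_{m+1}w+\sum_{k=m+2}^{\infty}(S_{k-3}a)\,\Delta_k w ,$$ and $[\Delta_\nu,T^m_a]w=\Delta_\nu(T^m_a w)-T^m_a(\Delta_\nu w)$. Let $m\in\mathbb N$ and $s\in(0,1)$. There is a constant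 $C_{m,s}\ge 0$, depending only on $m$, $s$, $n$ and $\chi$, such that for all $a\in\mathrm{Lip}$, all $u\in H^{1-s}(\mathbb R^n)$ and all $j,h\in\{1,\dots,n\}$ the series defining $T^m_a\partial_{x_h}u$ and $T^m_a\Delta_\nu\partial_{x_h}u$ ($\nu\ge0$) converge unconditionally in the space of tempered distributions, the distributions $\partial_{x_j}([\Delta_\nu,T^m_a]\partial_{x_h}u)$ are in $L^2$, and $$\Big(\sum_{\nu=0}^{+\infty}2^{-2\nu s}\,\big\|\partial_{x_j}\big([\Delta_\nu,T^m_a]\partial_{x_h}u\big)\big\|_{L^2}^2\Big)^{1/2}\le C_{m,s}\,\|a\|_{\mathrm{Lip}}\,\|u\|_{H^{1-s}} ,$$ where $\|u\|_{H^{\sigma}}=\|(1+|D|^2)^{\sigma/2}u\|_{L^2}$. -/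

import Mathlib

open MeasureTheory FourierTransform TemperedDistribution
open scoped SchwartzMap ENNReal NNReal LineDeriv

noncomputable section

namespace LittlewoodPaley

/-- The admissible radial profiles of the decomposition: `χ ∈ C^∞_0(ℝ)`, even, `0 ≤ χ ≤ 1`,
`χ = 1` on `|t| ≤ 11/10` and `χ = 0` on `|t| ≥ 19/10`. -/
structure IsCutoff (χ : ℝ → ℝ) : Prop where
  contDiff : ContDiff ℝ (⊤ : ℕ∞) χ
  even : ∀ t, χ (-t) = χ t
  nonneg : ∀ t, 0 ≤ χ t
  le_one : ∀ t, χ t ≤ 1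
  eq_one : ∀ t, |t| ≤ 11 / 10 → χ t = 1
  eq_zero : ∀ t, 19 / 10 ≤ |t| → χ t = 0

/-- The operator `g(D)`, `D = -i∂`, on tempered distributions. Mathlib's Fourier transform has
the kernel `exp (-2πi x·η)`, so the frequency of `D` is `ξ = 2πη`. -/
def multiplier {n : ℕ} (g : EuclideanSpace ℝ (Fin n) → ℂ) :
    𝓢'(EuclideanSpace ℝ (Fin n), ℂ) →L[ℂ] 𝓢'(EuclideanSpace ℝ (Fin n), ℂ) :=
  fourierMultiplierCLM ℂ (fun η ↦ g ((2 * Real.pi) • η))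

/-- The symbol `χ_k(ξ) = χ(2^{-k} |ξ|)`. -/
def symbol {n : ℕ} (χ : ℝ → ℝ) (k : ℤ) (ξ : EuclideanSpace ℝ (Fin n)) : ℂ :=
  (χ ((2 : ℝ) ^ (-k) * ‖ξ‖) : ℂ)

/-- `S_k = χ_k(D)` for `k ≥ 0`, on tempered distributions; `S_{-1} = 0`. -/
def S {n : ℕ} (χ : ℝ → ℝ) (k : ℤ) :
    𝓢'(EuclideanSpace ℝ (Fin n), ℂ) →L[ℂ] 𝓢'(EuclideanSpace ℝ (Fin n), ℂ) :=
  if k < 0 then 0 else multiplier (symbol χ k)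

/-- `Δ_0 = S_0` and `Δ_k = S_k - S_{k-1}` for `k ≥ 1` (recall `S_{-1} = 0`). -/
def Block {n : ℕ} (χ : ℝ → ℝ) (k : ℕ) :
    𝓢'(EuclideanSpace ℝ (Fin n), ℂ) →L[ℂ] 𝓢'(EuclideanSpace ℝ (Fin n), ℂ) :=
  S χ k - S χ ((k : ℤ) - 1)

/-- The inverse Fourier transform of `χ_k`, that is
`x ↦ (2π)^{-n} ∫ exp (i x·ξ) χ_k(ξ) dξ = ∫ exp (2πi x·η) χ_k(2πη) dη`. -/
def kernel {n : ℕ} (χ : ℝ → ℝ) (k : ℤ) : EuclideanSpace ℝ (Fin n) → ℂ :=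
  𝓕⁻ (fun η : EuclideanSpace ℝ (Fin n) ↦ symbol χ k ((2 * Real.pi) • η))

/-- `S_k a` for a bounded measurable function `a`, as a (smooth) function: the convolution of `a`
with the inverse Fourier transform of `χ_k` for `k ≥ 0`; `S_{-1} a = 0`. -/
def SFun {n : ℕ} (χ : ℝ → ℝ) (k : ℤ) (a : EuclideanSpace ℝ (Fin n) → ℂ) :
    EuclideanSpace ℝ (Fin n) → ℂ :=
  fun x ↦ if k < 0 then 0 else ∫ y, kernel χ k y * a (x - y)

/-- The term `S_{k-3} a · Δ_k w` of the paraproduct. The function `S_{k-3} a` is smooth with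
bounded derivatives, hence multiplies tempered distributions. -/
def paraTerm {n : ℕ} (χ : ℝ → ℝ) (a : EuclideanSpace ℝ (Fin n) → ℂ) (k : ℕ)
    (w : 𝓢'(EuclideanSpace ℝ (Fin n), ℂ)) : 𝓢'(EuclideanSpace ℝ (Fin n), ℂ) :=
  smulLeftCLM ℂ (SFun χ ((k : ℤ) - 3) a) (Block χ k w)

/-- The series `∑_{k ≥ m+2} S_{k-3} a · Δ_k w` converges (unconditionally) in the space of
tempered distributions, i.e. the modified paraproduct `T^m_a w` is defined. -/
def ParaConverges {n : ℕ} (χ : ℝ → ℝ) (m : ℕ) (a : EuclideanSpace ℝ (Fin n) → ℂ)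
    (w : 𝓢'(EuclideanSpace ℝ (Fin n), ℂ)) : Prop :=
  Summable fun i : ℕ ↦ paraTerm χ a (m + 2 + i) w

/-- The modified paraproduct
`T^m_a w = S_{m-1} a · S_{m+1} w + ∑_{k ≥ m+2} S_{k-3} a · Δ_k w`. -/
def para {n : ℕ} (χ : ℝ → ℝ) (m : ℕ) (a : EuclideanSpace ℝ (Fin n) → ℂ)
    (w : 𝓢'(EuclideanSpace ℝ (Fin n), ℂ)) : 𝓢'(EuclideanSpace ℝ (Fin n), ℂ) :=
  smulLeftCLM ℂ (SFun χ ((m : ℤ) - 1) a) (S χ ((m : ℤ) + 1) w)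
    + ∑' i : ℕ, paraTerm χ a (m + 2 + i) w

/-- The commutator `[Δ_ν, T^m_a] w = Δ_ν (T^m_a w) - T^m_a (Δ_ν w)`. -/
def comm {n : ℕ} (χ : ℝ → ℝ) (ν m : ℕ) (a : EuclideanSpace ℝ (Fin n) → ℂ)
    (w : 𝓢'(EuclideanSpace ℝ (Fin n), ℂ)) : 𝓢'(EuclideanSpace ℝ (Fin n), ℂ) :=
  Block χ ν (para χ m a w) - para χ m a (Block χ ν w)

/-- The partial derivative `∂_{x_j}` of a tempered distribution. -/
def partialD {n : ℕ} (j : Fin n) (w : 𝓢'(EuclideanSpace ℝ (Fin n), ℂ)) :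
    𝓢'(EuclideanSpace ℝ (Fin n), ℂ) :=
  ∂_{EuclideanSpace.single j (1 : ℝ)} w

/-- The `L²` norm of a tempered distribution, equal to `∞` if it is not in `L²`. (At most one
`f ∈ L²` represents a given tempered distribution.) -/
def l2Norm {n : ℕ} (w : 𝓢'(EuclideanSpace ℝ (Fin n), ℂ)) : ℝ≥0∞ :=
  ⨅ (f : Lp ℂ 2 (volume : Measure (EuclideanSpace ℝ (Fin n))))
    (_ : Lp.toTemperedDistribution f = w), ‖f‖ₑ

/-- The norm `‖u‖_{H^σ} = ‖(1 + |D|²)^{σ/2} u‖_{L²}`, equal to `∞` if `u` is not in `H^σ`. -/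
def sobolevNorm {n : ℕ} (σ : ℝ) (u : 𝓢'(EuclideanSpace ℝ (Fin n), ℂ)) : ℝ≥0∞ :=
  l2Norm (multiplier (fun ξ ↦ (((1 + ‖ξ‖ ^ 2) ^ (σ / 2) : ℝ) : ℂ)) u)

/-- `a ∈ Lip`: `a` is bounded and Lipschitz continuous. -/
structure IsLip {n : ℕ} (a : EuclideanSpace ℝ (Fin n) → ℂ) : Prop where
  bounded : ∃ M : ℝ, ∀ x, ‖a x‖ ≤ M
  lipschitz : ∃ K : ℝ≥0, LipschitzWith K a

/-- `‖a‖_Lip = ‖a‖_{L^∞} + ‖∇a‖_{L^∞}`; a Lipschitz function is differentiable almost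
everywhere. -/
def lipNorm {n : ℕ} (a : EuclideanSpace ℝ (Fin n) → ℂ) : ℝ≥0∞ :=
  eLpNorm a ∞ volume + eLpNorm (fderiv ℝ a) ∞ volume

end LittlewoodPaley

end

/-!
The estimate is proved by duality: a tempered distribution `T` is in `L²` with norm at most `C` as
soon as `|T φ| ≤ C ‖φ‖` for all Schwartz functions `φ` (`exists_lp_of_bound`).

With `b_k = S_{max (m-1) (k-3)} a` the paraproduct is the single series `∑ b_k Δ_k w`
(`hasSum_para`), so that `∂_j [Δ_ν, T^m_a] w = ∑ ∂_j [Δ_ν, b_k] Δ_k w`. Two facts control the terms.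

* Frequency localization. The term vanishes unless `|k - ν| ≤ m + 4` (`commTerm_eq_zero`), because
  the Fourier transform of a product is a convolution (`fourierInv_mollify_mul_eq_zero`).
* The commutator gains one derivative. By transposition the term tested against `φ` is `Δ_k w` tested
  against `[Δ_ν, b_k] ∂_j φ`. An integration by parts puts the derivative on the kernel
  `κ_ν(x - y) (b_k y - b_k x)` of the commutator (`norm_commutator_lineDeriv_apply_le`). As
  `|b_k y - b_k x| ≤ ‖∇b_k‖ |x - y|`, the result is dominated by the convolution of `|φ|` with
  `‖∇b_k‖ (|κ_ν| + |y||∇κ_ν|)`, whose integral does not depend on `ν` by scaling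
  (`integral_weight_kernelSchwartz`). Young's inequality bounds it in `L²`
  (`norm_toLp_commutator_block_le`), and `‖∇b_k‖` is at most a constant times `‖∇a‖`
  (`norm_fderiv_SFun_le`).

Hence the `ν`-th commutator is bounded by a constant times `‖∇a‖ ∑ ‖Δ_k w‖`, the sum being over
`|k - ν| ≤ m + 4`. For `w = ∂_h u` and `f = (1 + |D|²)^{(1-s)/2} u` one has
`‖Δ_k w‖ ≲ 2^{ks} ‖Δ_k f‖` (`exists_lp_block_partialD`); the weights `2^{-νs}` cancel the powers up to
a factor that depends on `m`, and the sum over `ν` is bounded by almost orthogonality of the blocks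
(`tsum_blockNorm_sq_le`).

The series `T^m_a ∂_h u` converges although `∂_h u` has negative regularity: by the product rule
`b_k Δ_k ∂_h u = ∂_h (b_k Δ_k u) - (∂_h b_k) Δ_k u`, and both series on the right converge
absolutely in `L²` before the derivative is taken (`paraConverges_partialD`).
-/

namespace LittlewoodPaley

/-! ### Duality of `L²` with the Schwartz functions -/

section Duality

variable {E : Type*} [NormedAddCommGroup E] [InnerProductSpace ℝ E] [FiniteDimensional ℝ E]
  [MeasurableSpace E] [BorelSpace E]

theorem norm_star_lp (f : Lp ℂ 2 (volume : Measure E)) : ‖star f‖ = ‖f‖ := by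
  rw [Lp.norm_def, Lp.norm_def]
  congr 1
  refine eLpNorm_congr_norm_ae ?_
  filter_upwards [Lp.coeFn_star f] with x hx
  simp [hx]

/-- A tempered distribution that is bounded for the `L²` norm of the test function is represented
by an `L²` function (Riesz representation and density of the Schwartz functions). -/
theorem exists_lp_of_bound (T : 𝓢'(E, ℂ)) (C : ℝ) (hC : 0 ≤ C)
    (h : ∀ φ : 𝓢(E, ℂ), ‖T φ‖ ≤ C * ‖φ.toLp 2‖) :
    ∃ f : Lp ℂ 2 (volume : Measure E), Lp.toTemperedDistribution f = T ∧ ‖f‖ ≤ C := by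
  have hd : DenseRange (SchwartzMap.toLpCLM ℂ (E := E) ℂ 2 volume) :=
    SchwartzMap.denseRange_toLpCLM ENNReal.ofNat_ne_top
  let e : 𝓢(E, ℂ) →ₗ[ℂ] Lp ℂ 2 (volume : Measure E) :=
    (SchwartzMap.toLpCLM ℂ (E := E) ℂ 2 volume).toLinearMap
  let T' : 𝓢(E, ℂ) →ₗ[ℂ] ℂ := T.toLinearMap
  let ext : StrongDual ℂ (Lp ℂ 2 (volume : Measure E)) := T'.extendOfNorm e
  have hext : ∀ φ : 𝓢(E, ℂ), ext (φ.toLp 2) = T φ := fun φ ↦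
    LinearMap.extendOfNorm_eq (f := T') (e := e) hd ⟨C, h⟩ φ
  have hnorm : ‖ext‖ ≤ C := LinearMap.opNorm_extendOfNorm_le (f := T') (e := e) hd hC h
  let g : Lp ℂ 2 (volume : Measure E) := (InnerProductSpace.toDual ℂ _).symm ext
  refine ⟨star g, ?_, ?_⟩
  · ext φ
    rw [Lp.toTemperedDistribution_apply, ← hext φ,
      ← InnerProductSpace.toDual_symm_apply (𝕜 := ℂ) (y := ext), L2.inner_def]
    refine integral_congr_ae ?_
    filter_upwards [Lp.coeFn_star g, φ.coeFn_toLp 2 volume] with x hx hφ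
    simp [hx, hφ, g]
  · rw [norm_star_lp]
    simpa [g] using hnorm

/-- The Cauchy-Schwarz bound for the pairing of an `L²` function with a test function. -/
theorem norm_toTemperedDistribution_apply_le (f : Lp ℂ 2 (volume : Measure E)) (φ : 𝓢(E, ℂ)) :
    ‖Lp.toTemperedDistribution f φ‖ ≤ ‖f‖ * ‖φ.toLp 2‖ := by
  have h : Lp.toTemperedDistribution f φ = inner ℂ (star f) (φ.toLp 2) := by
    rw [Lp.toTemperedDistribution_apply, L2.inner_def]
    refine integral_congr_ae ?_
    filter_upwards [Lp.coeFn_star f, φ.coeFn_toLp 2 volume] with x hx hφ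
    simp [hx, hφ]
  rw [h, ← norm_star_lp f]
  exact norm_inner_le_norm _ _

theorem toTemperedDistribution_injective :
    Function.Injective (fun f : Lp ℂ 2 (volume : Measure E) ↦ Lp.toTemperedDistribution f) :=
  LinearMap.ker_eq_bot.1 (Lp.ker_toTemperedDistributionCLM_eq_bot (F := ℂ) (μ := volume) (p := 2))

/-- A Fourier multiplier `g` acts on `L²`, and the norm of the image is the `L²` norm of `g` times
the Fourier transform. -/
theorem exists_lp_fourierMultiplier {g : E → ℂ} (hg : g.HasTemperateGrowth)
    {C : ℝ} (hC : ∀ x, ‖g x‖ ≤ C) (f : Lp ℂ 2 (volume : Measure E)) :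
    ∃ F : Lp ℂ 2 (volume : Measure E),
      Lp.toTemperedDistribution F = fourierMultiplierCLM ℂ g (Lp.toTemperedDistribution f) ∧
      ‖F‖ₑ = eLpNorm (fun x ↦ g x * (𝓕 f : Lp ℂ 2 (volume : Measure E)) x) 2 volume := by
  have hm : MemLp g ∞ (volume : Measure E) :=
    memLp_top_of_bound hg.1.continuous.aestronglyMeasurable C (.of_forall hC)
  refine ⟨𝓕⁻ ((hm.toLp g) • (𝓕 f : Lp ℂ 2 (volume : Measure E)) : Lp ℂ 2 (volume : Measure E)),
    ?_, ?_⟩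
  · rw [fourierMultiplierCLM_apply, Lp.fourier_toTemperedDistribution_eq,
      ← Lp.toTemperedDistribution_smul_eq (r := 2) hg hm, Lp.fourierInv_toTemperedDistribution_eq]
  · have : ∀ G : Lp ℂ 2 (volume : Measure E), ‖𝓕⁻ G‖ₑ = ‖G‖ₑ := fun G ↦
      (Lp.fourierTransformₗᵢ E ℂ).symm.enorm_map G
    rw [this, Lp.enorm_def]
    refine eLpNorm_congr_ae ?_
    filter_upwards [Lp.coeFn_lpSMul (r := 2) (hm.toLp g) (𝓕 f : Lp ℂ 2 (volume : Measure E)),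
      hm.coeFn_toLp] with x h1 h2
    simp [h1, h2]

/-- Multiplication by a bounded function of temperate growth acts on `L²`. -/
theorem exists_lp_smulLeft {g : E → ℂ} (hg : g.HasTemperateGrowth)
    {C : ℝ} (hC : ∀ x, ‖g x‖ ≤ C) (f : Lp ℂ 2 (volume : Measure E)) :
    ∃ F : Lp ℂ 2 (volume : Measure E),
      Lp.toTemperedDistribution F = smulLeftCLM ℂ g (Lp.toTemperedDistribution f) ∧
      ‖F‖ ≤ C * ‖f‖ := by
  have hm : MemLp g ∞ (volume : Measure E) :=
    memLp_top_of_bound hg.1.continuous.aestronglyMeasurable C (.of_forall hC)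
  refine ⟨((hm.toLp g) • f : Lp ℂ 2 (volume : Measure E)),
    Lp.toTemperedDistribution_smul_eq hg hm f, ?_⟩
  refine Lp.norm_le_mul_norm_of_ae_le_mul ?_
  filter_upwards [Lp.coeFn_lpSMul (r := 2) (hm.toLp g) f, hm.coeFn_toLp] with x h1 h2
  simpa [h1, h2] using mul_le_mul_of_nonneg_right (hC x) (norm_nonneg _)

end Duality

section L2Norm

variable {n : ℕ}

theorem l2Norm_toTemperedDistribution (f : Lp ℂ 2 (volume : Measure (EuclideanSpace ℝ (Fin n)))) :
    l2Norm (Lp.toTemperedDistribution f) = ‖f‖ₑ := by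
  refine le_antisymm (iInf_le_of_le f (iInf_le_of_le rfl le_rfl)) (le_iInf₂ fun g hg ↦ ?_)
  rw [toTemperedDistribution_injective hg]

theorem l2Norm_le_of_bound (T : 𝓢'(EuclideanSpace ℝ (Fin n), ℂ)) (C : ℝ) (hC : 0 ≤ C)
    (h : ∀ φ : 𝓢(EuclideanSpace ℝ (Fin n), ℂ), ‖T φ‖ ≤ C * ‖φ.toLp 2‖) :
    l2Norm T ≤ ENNReal.ofReal C := by
  obtain ⟨f, rfl, hf⟩ := exists_lp_of_bound T C hC h
  rw [l2Norm_toTemperedDistribution, ← ofReal_norm]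
  exact ENNReal.ofReal_le_ofReal hf

end L2Norm

/-! ### The symbols of the decomposition -/

section Symbols

variable {n : ℕ} {χ : ℝ → ℝ}

/-- The symbol of `S_k` in the frequency variable of Mathlib's Fourier transform, extended by `0`
to negative `k`. -/
noncomputable def lowSymbol (χ : ℝ → ℝ) (k : ℤ) (η : EuclideanSpace ℝ (Fin n)) : ℂ :=
  if k < 0 then 0 else symbol χ k ((2 * Real.pi) • η)

/-- The symbol of `Δ_k` in the frequency variable of Mathlib's Fourier transform. -/
noncomputable def blockSymbol (χ : ℝ → ℝ) (k : ℕ) (η : EuclideanSpace ℝ (Fin n)) : ℂ :=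
  lowSymbol χ k η - lowSymbol χ ((k : ℤ) - 1) η

/-- The modulus `|ξ| = 2π|η|` of the frequency of `D`. -/
noncomputable def freq (η : EuclideanSpace ℝ (Fin n)) : ℝ := 2 * Real.pi * ‖η‖

theorem freq_nonneg (η : EuclideanSpace ℝ (Fin n)) : 0 ≤ freq η := by
  unfold freq; positivity

theorem freq_neg (η : EuclideanSpace ℝ (Fin n)) : freq (-η) = freq η := by
  simp [freq]

theorem freq_add_le (η ζ : EuclideanSpace ℝ (Fin n)) : freq (η + ζ) ≤ freq η + freq ζ := by
  unfold freq
  rw [← mul_add]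
  gcongr
  exact norm_add_le _ _

theorem norm_two_pi_smul (η : EuclideanSpace ℝ (Fin n)) : ‖(2 * Real.pi) • η‖ = freq η := by
  rw [norm_smul, freq, Real.norm_of_nonneg (by positivity)]

theorem lowSymbol_of_neg {k : ℤ} (hk : k < 0) (η : EuclideanSpace ℝ (Fin n)) :
    lowSymbol χ k η = 0 := by
  simp [lowSymbol, hk]

theorem lowSymbol_of_nonneg {k : ℤ} (hk : 0 ≤ k) (η : EuclideanSpace ℝ (Fin n)) :
    lowSymbol χ k η = (χ ((2 : ℝ) ^ (-k) * freq η) : ℂ) := by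
  simp [lowSymbol, not_lt.2 hk, symbol, norm_two_pi_smul]

theorem lowSymbol_even (k : ℤ) (η : EuclideanSpace ℝ (Fin n)) :
    lowSymbol χ k (-η) = lowSymbol χ k η := by
  simp [lowSymbol, symbol]

theorem blockSymbol_even (k : ℕ) (η : EuclideanSpace ℝ (Fin n)) :
    blockSymbol χ k (-η) = blockSymbol χ k η := by
  simp [blockSymbol, lowSymbol_even]

theorem S_eq (χ : ℝ → ℝ) (k : ℤ) :
    S (n := n) χ k = fourierMultiplierCLM ℂ (lowSymbol χ k) := by
  rcases lt_or_ge k 0 with hk | hk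
  · have : lowSymbol (n := n) χ k = fun _ ↦ 0 := funext fun η ↦ lowSymbol_of_neg hk η
    rw [this]
    simp [S, hk]
  · have : lowSymbol (n := n) χ k = fun η ↦ symbol χ k ((2 * Real.pi) • η) :=
      funext fun η ↦ by simp [lowSymbol, not_lt.2 hk]
    rw [this]
    simp [S, not_lt.2 hk, multiplier]

theorem sum_blockSymbol (K : ℕ) (η : EuclideanSpace ℝ (Fin n)) :
    ∑ k ∈ Finset.range (K + 1), blockSymbol χ k η = lowSymbol χ K η := by
  induction K with
  | zero => simp [blockSymbol, lowSymbol_of_neg]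
  | succ K ih =>
    rw [Finset.sum_range_succ, ih, blockSymbol]
    push_cast
    simp

namespace IsCutoff

/-- The symbol of `S_k` equals `1` for `|ξ| ≤ (11/10) 2^k`. -/
theorem lowSymbol_eq_one (hχ : IsCutoff χ) {k : ℤ} (hk : 0 ≤ k) {η : EuclideanSpace ℝ (Fin n)}
    (h : freq η ≤ 11 / 10 * 2 ^ k) : lowSymbol χ k η = 1 := by
  rw [lowSymbol_of_nonneg hk, hχ.eq_one, Complex.ofReal_one]
  have := freq_nonneg η
  rw [abs_of_nonneg (by positivity), zpow_neg, inv_mul_le_iff₀ (by positivity)]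
  linarith

theorem lowSymbol_eq_zero (hχ : IsCutoff χ) {k : ℤ} {η : EuclideanSpace ℝ (Fin n)}
    (h : 19 / 10 * 2 ^ k ≤ freq η) : lowSymbol χ k η = 0 := by
  rcases lt_or_ge k 0 with hk | hk
  · exact lowSymbol_of_neg hk η
  rw [lowSymbol_of_nonneg hk, hχ.eq_zero, Complex.ofReal_zero]
  have := freq_nonneg η
  rw [abs_of_nonneg (by positivity), zpow_neg, le_inv_mul_iff₀ (by positivity)]
  linarith

theorem contDiff_lowSymbol (hχ : IsCutoff χ) (k : ℤ) :
    ContDiff ℝ (⊤ : ℕ∞) (lowSymbol (n := n) χ k) := by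
  rcases lt_or_ge k 0 with hk | hk
  · have : lowSymbol (n := n) χ k = fun _ ↦ 0 := funext fun η ↦ lowSymbol_of_neg hk η
    rw [this]
    exact contDiff_const
  rw [contDiff_iff_contDiffAt]
  intro η
  rcases eq_or_ne η 0 with rfl | hη
  · -- the symbol is constant near the origin, where the norm is not smooth
    refine (contDiffAt_const (c := (1 : ℂ))).congr_of_eventuallyEq ?_
    have hcont : Continuous (fun η : EuclideanSpace ℝ (Fin n) ↦ freq η) := by
      unfold freq; fun_prop
    have h0 : freq (0 : EuclideanSpace ℝ (Fin n)) < 11 / 10 * 2 ^ k := by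
      simp only [freq, norm_zero, mul_zero]; positivity
    filter_upwards [hcont.continuousAt.eventually_lt continuousAt_const h0] with ζ hζ
    exact hχ.lowSymbol_eq_one hk hζ.le
  · have : lowSymbol (n := n) χ k
        = fun η ↦ Complex.ofRealCLM (χ ((2 : ℝ) ^ (-k) * (2 * Real.pi * ‖η‖))) := by
      funext ζ
      rw [lowSymbol_of_nonneg hk]; rfl
    rw [this]
    refine Complex.ofRealCLM.contDiff.contDiffAt.comp η (hχ.contDiff.contDiffAt.comp η ?_)
    exact contDiffAt_const.mul (contDiffAt_const.mul (contDiffAt_norm ℝ hη))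

theorem hasCompactSupport_lowSymbol (hχ : IsCutoff χ) (k : ℤ) :
    HasCompactSupport (lowSymbol (n := n) χ k) := by
  refine HasCompactSupport.intro
    (isCompact_closedBall (0 : EuclideanSpace ℝ (Fin n)) (19 / 10 * 2 ^ k)) fun η hη ↦ ?_
  refine hχ.lowSymbol_eq_zero ?_
  simp only [Metric.mem_closedBall, dist_zero_right, not_le] at hη
  have : (1 : ℝ) ≤ 2 * Real.pi := by linarith [Real.pi_gt_three]
  unfold freq
  nlinarith [norm_nonneg η]

theorem hasTemperateGrowth_lowSymbol (hχ : IsCutoff χ) (k : ℤ) :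
    (lowSymbol (n := n) χ k).HasTemperateGrowth :=
  (hχ.hasCompactSupport_lowSymbol k).hasTemperateGrowth (hχ.contDiff_lowSymbol k)

theorem hasTemperateGrowth_blockSymbol (hχ : IsCutoff χ) (k : ℕ) :
    (blockSymbol (n := n) χ k).HasTemperateGrowth :=
  (hχ.hasTemperateGrowth_lowSymbol k).sub (hχ.hasTemperateGrowth_lowSymbol _)

theorem block_eq (hχ : IsCutoff χ) (k : ℕ) :
    Block (n := n) χ k = fourierMultiplierCLM ℂ (blockSymbol χ k) := by
  have h : blockSymbol (n := n) χ k = lowSymbol χ k - lowSymbol χ ((k : ℤ) - 1) := rfl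
  ext u φ
  simp only [Block, S_eq, h, fourierMultiplierCLM_apply_apply, _root_.sub_apply,
    SchwartzMap.smulLeftCLM_sub (hχ.hasTemperateGrowth_lowSymbol _)
    (hχ.hasTemperateGrowth_lowSymbol _)]
  rw [← map_sub]
  exact congrArg u (map_sub (fourierCLM ℂ 𝓢(EuclideanSpace ℝ (Fin n), ℂ)) _ _).symm

theorem blockSymbol_eq_zero_of_ge (hχ : IsCutoff χ) {k : ℕ} {η : EuclideanSpace ℝ (Fin n)}
    (h : 19 / 10 * 2 ^ k ≤ freq η) : blockSymbol χ k η = 0 := by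
  rw [blockSymbol, hχ.lowSymbol_eq_zero (by simpa using h), hχ.lowSymbol_eq_zero, sub_zero]
  refine le_trans ?_ h
  rw [zpow_sub_one₀ (by norm_num), zpow_natCast]
  have : (0 : ℝ) < 2 ^ k := by positivity
  linarith

theorem blockSymbol_eq_zero_of_le (hχ : IsCutoff χ) {k : ℕ} (hk : 1 ≤ k)
    {η : EuclideanSpace ℝ (Fin n)} (h : freq η ≤ 11 / 20 * 2 ^ k) : blockSymbol χ k η = 0 := by
  have : (0 : ℝ) < 2 ^ k := by positivity
  rw [blockSymbol, hχ.lowSymbol_eq_one (by positivity), hχ.lowSymbol_eq_one (by omega), sub_self]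
  · rw [zpow_sub_one₀ (by norm_num), zpow_natCast]
    linarith
  · rw [zpow_natCast]; linarith

/-- `Δ_k` has a symbol with values in `[0, 1]`: where the symbol of `S_{k-1}` does not vanish, that
of `S_k` equals `1`. -/
theorem exists_blockSymbol_eq (hχ : IsCutoff χ) (k : ℕ) (η : EuclideanSpace ℝ (Fin n)) :
    ∃ r : ℝ, 0 ≤ r ∧ r ≤ 1 ∧ blockSymbol χ k η = r := by
  have hlow : ∀ j : ℤ, ∃ r : ℝ, 0 ≤ r ∧ r ≤ 1 ∧ lowSymbol χ j η = r := fun j ↦ by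
    rcases lt_or_ge j 0 with hj | hj
    · exact ⟨0, le_rfl, zero_le_one, by simp [lowSymbol_of_neg hj]⟩
    · exact ⟨_, hχ.nonneg _, hχ.le_one _, lowSymbol_of_nonneg hj η⟩
  rcases le_total (freq η) (11 / 10 * 2 ^ k) with h | h
  · obtain ⟨r, h0, h1, hr⟩ := hlow ((k : ℤ) - 1)
    refine ⟨1 - r, by linarith, by linarith, ?_⟩
    rw [blockSymbol, hχ.lowSymbol_eq_one (by positivity) (by simpa using h), hr]
    simp
  · obtain ⟨r, h0, h1, hr⟩ := hlow k
    refine ⟨r, h0, h1, ?_⟩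
    rw [blockSymbol, hr, hχ.lowSymbol_eq_zero, sub_zero]
    refine le_trans ?_ h
    rw [zpow_sub_one₀ (by norm_num), zpow_natCast]
    have : (0 : ℝ) < 2 ^ k := by positivity
    linarith

theorem norm_blockSymbol_le_one (hχ : IsCutoff χ) (k : ℕ) (η : EuclideanSpace ℝ (Fin n)) :
    ‖blockSymbol χ k η‖ ≤ 1 := by
  obtain ⟨r, h0, h1, hr⟩ := hχ.exists_blockSymbol_eq k η
  rw [hr, Complex.norm_real, Real.norm_of_nonneg h0]
  exact h1

theorem norm_lowSymbol_le_one (hχ : IsCutoff χ) (k : ℤ) (η : EuclideanSpace ℝ (Fin n)) :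
    ‖lowSymbol χ k η‖ ≤ 1 := by
  rcases lt_or_ge k 0 with hk | hk
  · simp [lowSymbol_of_neg hk]
  · rw [lowSymbol_of_nonneg hk, Complex.norm_real, Real.norm_of_nonneg (hχ.nonneg _)]
    exact hχ.le_one _

/-- The symbols `b_k` of the blocks take values in `[0, 1]` and add up to at most `1`; hence
`∑ b_k² ≤ ∑ b_k ≤ 1`. -/
theorem sum_norm_blockSymbol_sq_le (hχ : IsCutoff χ) (K : ℕ) (η : EuclideanSpace ℝ (Fin n)) :
    ∑ k ∈ Finset.range K, ‖blockSymbol χ k η‖ ^ 2 ≤ 1 := by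
  choose r h0 h1 hr using fun k ↦ hχ.exists_blockSymbol_eq (n := n) k η
  calc ∑ k ∈ Finset.range K, ‖blockSymbol χ k η‖ ^ 2 ≤ ∑ k ∈ Finset.range K, r k := by
        refine Finset.sum_le_sum fun k _ ↦ ?_
        rw [hr, Complex.norm_real, Real.norm_of_nonneg (h0 k)]
        nlinarith [h0 k, h1 k]
    _ ≤ ∑ k ∈ Finset.range (K + 1), r k :=
        Finset.sum_le_sum_of_subset_of_nonneg (Finset.range_mono (Nat.le_succ K))
          fun k _ _ ↦ h0 k
    _ = ‖(∑ k ∈ Finset.range (K + 1), r k : ℂ)‖ := by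
        rw [← Complex.ofReal_sum, Complex.norm_real,
          Real.norm_of_nonneg (Finset.sum_nonneg fun k _ ↦ h0 k)]
    _ = ‖lowSymbol χ K η‖ := by
        rw [← sum_blockSymbol]
        simp_rw [hr]
    _ ≤ 1 := hχ.norm_lowSymbol_le_one _ _

end IsCutoff

end Symbols

/-! ### Mollification of bounded functions -/

section Mollification

variable {E : Type} [NormedAddCommGroup E] [InnerProductSpace ℝ E] [FiniteDimensional ℝ E]
  [MeasurableSpace E] [BorelSpace E]
  {F : Type} [NormedAddCommGroup F] [NormedSpace ℝ F]

/-- Schwartz decay that is locally uniform under translations, in integrable form. -/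
theorem exists_integrable_bound_translates (κ : 𝓢(E, F)) (x₀ : E) :
    ∃ B : E → ℝ, Integrable B ∧ ∀ x ∈ Metric.ball x₀ 1, ∀ y, ‖κ (x - y)‖ ≤ B y := by
  set N := (volume : Measure E).integrablePower
  obtain ⟨C, hC⟩ : ∃ C : ℝ, ∀ z, (1 + ‖z‖) ^ N * ‖κ z‖ ≤ C := by
    refine ⟨2 ^ N * (Finset.Iic (N, 0)).sup (fun m ↦ SchwartzMap.seminorm ℝ m.1 m.2) κ,
      fun z ↦ ?_⟩
    simpa using SchwartzMap.one_add_le_sup_seminorm_apply (𝕜 := ℝ) (m := (N, 0)) le_rfl le_rfl κ z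
  refine ⟨fun y ↦ 2 ^ N * C * (1 + ‖x₀ - y‖) ^ (-(N : ℝ)),
    ((Measure.integrable_pow_neg_integrablePower (volume : Measure E)).comp_sub_left x₀).const_mul _,
    fun x hx y ↦ ?_⟩
  have h1 : 1 + ‖x₀ - y‖ ≤ 2 * (1 + ‖x - y‖) := by
    have h2 : ‖x₀ - y‖ ≤ ‖x₀ - x‖ + ‖x - y‖ := norm_sub_le_norm_sub_add_norm_sub _ _ _
    have h3 : ‖x₀ - x‖ < 1 := by simpa [dist_eq_norm, norm_sub_rev] using hx
    linarith [norm_nonneg (x - y)]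
  beta_reduce
  rw [Real.rpow_neg (by positivity), Real.rpow_natCast, ← div_eq_mul_inv,
    le_div_iff₀ (by positivity)]
  calc ‖κ (x - y)‖ * (1 + ‖x₀ - y‖) ^ N ≤ ‖κ (x - y)‖ * (2 * (1 + ‖x - y‖)) ^ N := by gcongr
    _ = 2 ^ N * ((1 + ‖x - y‖) ^ N * ‖κ (x - y)‖) := by rw [mul_pow]; ring
    _ ≤ 2 ^ N * C := by gcongr; exact hC _

variable [NormedSpace ℂ F]

/-- The convolution of a function `a` with a (vector valued) Schwartz function. -/
noncomputable def mollify (a : E → ℂ) (κ : 𝓢(E, F)) (x : E) : F := ∫ y, a y • κ (x - y)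

variable {a : E → ℂ} {M : ℝ}

theorem integrable_mollify (ha : AEStronglyMeasurable a) (hM : ∀ x, ‖a x‖ ≤ M) (κ : 𝓢(E, F))
    (x : E) : Integrable fun y ↦ a y • κ (x - y) :=
  (κ.integrable.comp_sub_left x).bdd_smul M ha (.of_forall hM)

theorem norm_mollify_le (hM : ∀ x, ‖a x‖ ≤ M) (κ : 𝓢(E, F)) (x : E) :
    ‖mollify a κ x‖ ≤ M * ∫ y, ‖κ y‖ := by
  rw [← integral_sub_left_eq_self (fun y ↦ ‖κ y‖) volume x, ← integral_const_mul]
  refine norm_integral_le_of_norm_le ((κ.integrable.norm.comp_sub_left x).const_mul M) ?_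
  refine .of_forall fun y ↦ ?_
  rw [norm_smul]
  gcongr
  exact hM y

theorem hasFDerivAt_mollify [SMulCommClass ℝ ℂ F] (ha : AEStronglyMeasurable a)
    (hM : ∀ x, ‖a x‖ ≤ M) (κ : 𝓢(E, F)) (x₀ : E) :
    HasFDerivAt (mollify a κ) (mollify a (SchwartzMap.fderivCLM ℝ E F κ) x₀) x₀ := by
  obtain ⟨B, hB, hκ⟩ := exists_integrable_bound_translates (SchwartzMap.fderivCLM ℝ E F κ) x₀
  have hM0 : 0 ≤ M := (norm_nonneg _).trans (hM x₀)
  refine hasFDerivAt_integral_of_dominated_of_fderiv_le (bound := fun y ↦ M * B y)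
    (F' := fun x y ↦ a y • SchwartzMap.fderivCLM ℝ E F κ (x - y))
    (Metric.ball_mem_nhds x₀ one_pos)
    (.of_forall fun x ↦ (integrable_mollify ha hM κ x).aestronglyMeasurable)
    (integrable_mollify ha hM κ x₀)
    (integrable_mollify ha hM (SchwartzMap.fderivCLM ℝ E F κ) x₀).aestronglyMeasurable
    (.of_forall fun y x hx ↦ ?_) (hB.const_mul M) (.of_forall fun y x hx ↦ ?_)
  · rw [norm_smul]
    gcongr
    · exact hM y
    · exact hκ x hx y
  · have := (κ.hasFDerivAt (x - y)).comp x ((hasFDerivAt_id x).sub_const y)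
    exact this.const_smul (a y)

/-- The target space is quantified inside the induction on the order, because the derivative of a
mollification is a mollification with values in a space of linear maps. -/
theorem contDiff_mollify (ha : AEStronglyMeasurable a) (hM : ∀ x, ‖a x‖ ≤ M) (N : ℕ) :
    ∀ {F : Type} [NormedAddCommGroup F] [NormedSpace ℝ F] [NormedSpace ℂ F] [SMulCommClass ℝ ℂ F]
      (κ : 𝓢(E, F)), ContDiff ℝ N (mollify a κ) ∧
        ∃ C, ∀ x, ‖iteratedFDeriv ℝ N (mollify a κ) x‖ ≤ C := by
  induction N with
  | zero =>
    intro F _ _ _ _ κ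
    refine ⟨contDiff_zero.2 ?_, M * ∫ y, ‖κ y‖, fun x ↦ ?_⟩
    · exact (show Differentiable ℝ (mollify a κ) from
        fun x ↦ (hasFDerivAt_mollify ha hM κ x).differentiableAt).continuous
    · rw [norm_iteratedFDeriv_zero]
      exact norm_mollify_le hM κ x
  | succ N ih =>
    intro F _ _ _ _ κ
    have hd : fderiv ℝ (mollify a κ) = mollify a (SchwartzMap.fderivCLM ℝ E F κ) :=
      funext fun x ↦ (hasFDerivAt_mollify ha hM κ x).fderiv
    obtain ⟨h1, C, hC⟩ := ih (SchwartzMap.fderivCLM ℝ E F κ)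
    refine ⟨?_, C, fun x ↦ ?_⟩
    · push_cast
      refine contDiff_succ_iff_fderiv.2
        ⟨fun x ↦ (hasFDerivAt_mollify ha hM κ x).differentiableAt, by simp, ?_⟩
      rw [hd]
      exact h1
    · rw [← norm_iteratedFDeriv_fderiv, hd]
      exact hC x

theorem hasTemperateGrowth_mollify [SMulCommClass ℝ ℂ F] (ha : AEStronglyMeasurable a)
    (hM : ∀ x, ‖a x‖ ≤ M) (κ : 𝓢(E, F)) : (mollify a κ).HasTemperateGrowth := by
  refine ⟨contDiff_infty.2 fun N ↦ (contDiff_mollify ha hM N κ).1, fun N ↦ ?_⟩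
  obtain ⟨C, hC⟩ := (contDiff_mollify ha hM N κ).2
  exact ⟨0, C, fun x ↦ by simpa using hC x⟩

/-- The gradient of a mollification of a Lipschitz function is controlled by the essential supremum
of the gradient: the difference quotients converge almost everywhere by Rademacher's theorem and
are dominated because the function is Lipschitz. -/
theorem norm_fderiv_mollify_le {K : ℝ≥0} (hM : ∀ x, ‖a x‖ ≤ M)
    (hK : LipschitzWith K a) {L : ℝ} (hL : 0 ≤ L) (hae : ∀ᵐ x, ‖fderiv ℝ a x‖ ≤ L) (κ : 𝓢(E, ℂ))
    (x : E) : ‖fderiv ℝ (mollify a κ) x‖ ≤ L * ∫ y, ‖κ y‖ := by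
  have ha : AEStronglyMeasurable a := hK.continuous.aestronglyMeasurable
  refine ContinuousLinearMap.opNorm_le_bound _ (by positivity) fun v ↦ ?_
  have hflip : ∀ x, mollify a κ x = ∫ y, a (x - y) * κ y := fun x ↦ by
    rw [← integral_sub_left_eq_self _ volume x]
    simp [mollify]
  have hint : ∀ x, Integrable fun y ↦ a (x - y) * κ y := fun x ↦ by
    refine κ.integrable.bdd_mul (c := M) ?_ (.of_forall fun y ↦ hM _)
    exact (hK.continuous.comp (by fun_prop)).aestronglyMeasurable
  have hlim := (hasFDerivAt_mollify ha hM κ x).differentiableAt.hasFDerivAt.lim_real v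
  have hdiff : ∀ᵐ y, DifferentiableAt ℝ a (x - y) :=
    (quasiMeasurePreserving_sub_left volume x).ae hK.ae_differentiableAt
  have hbd : ∀ᵐ y, ‖fderiv ℝ a (x - y)‖ ≤ L :=
    (quasiMeasurePreserving_sub_left volume x).ae hae
  have hlim2 : Filter.Tendsto (fun c : ℝ ↦ ∫ y, (c • (a (x + c⁻¹ • v - y) - a (x - y))) * κ y)
      Filter.atTop (nhds (∫ y, fderiv ℝ a (x - y) v * κ y)) := by
    refine tendsto_integral_filter_of_dominated_convergence (fun y ↦ K * ‖v‖ * ‖κ y‖) ?_ ?_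
      (κ.integrable.norm.const_mul _) ?_
    · refine .of_forall fun c ↦ (Continuous.aestronglyMeasurable ?_)
      have := hK.continuous
      have := κ.continuous
      fun_prop
    · filter_upwards [Filter.eventually_gt_atTop 0] with c hc
      refine .of_forall fun y ↦ ?_
      rw [norm_mul, norm_smul]
      refine mul_le_mul_of_nonneg_right ?_ (norm_nonneg _)
      have h1 := hK.norm_sub_le (x + c⁻¹ • v - y) (x - y)
      have h2 : x + c⁻¹ • v - y - (x - y) = c⁻¹ • v := by abel
      rw [h2, norm_smul, norm_inv] at h1
      have hc' : ‖c‖ ≠ 0 := by simpa using hc.ne'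
      calc ‖c‖ * ‖a (x + c⁻¹ • v - y) - a (x - y)‖ ≤ ‖c‖ * (K * (‖c‖⁻¹ * ‖v‖)) := by gcongr
        _ = K * ‖v‖ := by field_simp
    · filter_upwards [hdiff] with y hy
      refine Filter.Tendsto.mul_const _ ?_
      have := hy.hasFDerivAt.lim_real v
      refine this.congr fun c ↦ ?_
      rw [show x - y + c⁻¹ • v = x + c⁻¹ • v - y by abel]
  have heq : ∀ c : ℝ, c • (mollify a κ (x + c⁻¹ • v) - mollify a κ x)
      = ∫ y, (c • (a (x + c⁻¹ • v - y) - a (x - y))) * κ y := fun c ↦ by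
    rw [hflip, hflip, ← integral_sub (hint _) (hint _), ← integral_smul]
    congr 1
    ext y
    simp only [Complex.real_smul]
    ring
  rw [tendsto_nhds_unique (hlim.congr heq) hlim2, mul_right_comm, ← integral_const_mul]
  refine norm_integral_le_of_norm_le (κ.integrable.norm.const_mul _) ?_
  filter_upwards [hbd] with y hy
  rw [norm_mul]
  gcongr
  exact (ContinuousLinearMap.le_opNorm _ _).trans (by gcongr)

end Mollification

/-! ### The kernels of the decomposition -/

section Kernel

variable {n : ℕ} {χ : ℝ → ℝ}

/-- The weight `|κ| + |y||∇κ|` of a kernel; it controls the commutators with Lipschitz functions. -/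
noncomputable def weight (κ : 𝓢(EuclideanSpace ℝ (Fin n), ℂ)) (y : EuclideanSpace ℝ (Fin n)) : ℝ :=
  ‖κ y‖ + ‖y‖ * ‖fderiv ℝ κ y‖

theorem weight_nonneg (κ : 𝓢(EuclideanSpace ℝ (Fin n), ℂ)) (y : EuclideanSpace ℝ (Fin n)) :
    0 ≤ weight κ y := by unfold weight; positivity

theorem integrable_weight (κ : 𝓢(EuclideanSpace ℝ (Fin n), ℂ)) : Integrable (weight κ) := by
  refine κ.integrable.norm.add ?_
  simpa using (SchwartzMap.fderivCLM ℝ _ ℂ κ).integrable_pow_mul volume 1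

theorem continuous_weight (κ : 𝓢(EuclideanSpace ℝ (Fin n), ℂ)) : Continuous (weight κ) :=
  κ.continuous.norm.add (continuous_norm.mul (SchwartzMap.fderivCLM ℝ _ ℂ κ).continuous.norm)

namespace IsCutoff

/-- The symbol of `S_k` as a Schwartz function. -/
noncomputable def lowSchwartz (hχ : IsCutoff χ) (k : ℤ) : 𝓢(EuclideanSpace ℝ (Fin n), ℂ) :=
  (hχ.hasCompactSupport_lowSymbol k).toSchwartzMap (hχ.contDiff_lowSymbol k)

/-- The convolution kernel of `S_k` as a Schwartz function. -/
noncomputable def kernelSchwartz (hχ : IsCutoff χ) (k : ℤ) : 𝓢(EuclideanSpace ℝ (Fin n), ℂ) :=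
  𝓕⁻ (hχ.lowSchwartz k)

theorem lowSchwartz_apply (hχ : IsCutoff χ) (k : ℤ) (η : EuclideanSpace ℝ (Fin n)) :
    hχ.lowSchwartz k η = lowSymbol χ k η := rfl

theorem kernel_eq (hχ : IsCutoff χ) {k : ℤ} (hk : 0 ≤ k) :
    kernel (n := n) χ k = hχ.kernelSchwartz k := by
  rw [kernelSchwartz, SchwartzMap.fourierInv_coe, kernel]
  congr 1
  ext η
  simp [lowSchwartz_apply, lowSymbol, not_lt.2 hk]

/-- The kernels are the dilates `2^{kn} κ(2^k y)` of the kernel `κ` of `S_0`. -/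
theorem kernelSchwartz_scaling (hχ : IsCutoff χ) (k : ℕ) (y : EuclideanSpace ℝ (Fin n)) :
    hχ.kernelSchwartz (n := n) k y
      = ((2 : ℝ) ^ k) ^ n • hχ.kernelSchwartz (n := n) 0 ((2 : ℝ) ^ k • y) := by
  have h2 : (0 : ℝ) < 2 ^ k := by positivity
  simp only [kernelSchwartz, SchwartzMap.fourierInv_coe, Real.fourierInv_eq]
  have := Measure.integral_comp_smul (volume : Measure (EuclideanSpace ℝ (Fin n)))
    (fun v ↦ Real.fourierChar (inner ℝ v ((2 : ℝ) ^ k • y)) • hχ.lowSchwartz (n := n) 0 v)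
    ((2 : ℝ) ^ k)⁻¹
  simp only [finrank_euclideanSpace, Fintype.card_fin, inv_pow, inv_inv] at this
  rw [abs_of_pos (by positivity)] at this
  rw [← this]
  congr 1
  ext v
  rw [inner_smul_left, inner_smul_right]
  congr 1
  · congr 1
    simp [h2.ne']
  · rw [lowSchwartz_apply, lowSchwartz_apply, lowSymbol_of_nonneg (by positivity),
      lowSymbol_of_nonneg le_rfl]
    congr 2
    simp only [freq, norm_smul, norm_inv, Real.norm_of_nonneg h2.le]
    simp
    ring

theorem fderiv_kernelSchwartz_scaling (hχ : IsCutoff χ) (k : ℕ) (y : EuclideanSpace ℝ (Fin n)) :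
    fderiv ℝ (hχ.kernelSchwartz (n := n) k) y
      = (((2 : ℝ) ^ k) ^ n * 2 ^ k) • fderiv ℝ (hχ.kernelSchwartz (n := n) 0) ((2 : ℝ) ^ k • y) := by
  have h : ⇑(hχ.kernelSchwartz (n := n) k)
      = fun y ↦ ((2 : ℝ) ^ k) ^ n • hχ.kernelSchwartz (n := n) 0 ((2 : ℝ) ^ k • y) :=
    funext (hχ.kernelSchwartz_scaling k)
  have h1 := ((hχ.kernelSchwartz (n := n) 0).hasFDerivAt ((2 : ℝ) ^ k • y)).comp y
    ((hasFDerivAt_id y).const_smul ((2 : ℝ) ^ k))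
  rw [h]
  refine (h1.const_smul (((2 : ℝ) ^ k) ^ n)).fderiv.trans ?_
  ext v
  simp [mul_assoc]

/-- The scale invariance that makes the commutator estimate uniform in `k`. -/
theorem integral_weight_kernelSchwartz (hχ : IsCutoff χ) (k : ℕ) :
    ∫ y, weight (hχ.kernelSchwartz (n := n) k) y = ∫ y, weight (hχ.kernelSchwartz (n := n) 0) y := by
  have h2 : (0 : ℝ) < 2 ^ k := by positivity
  have h : ∀ y, weight (hχ.kernelSchwartz (n := n) k) y
      = ((2 : ℝ) ^ k) ^ n * weight (hχ.kernelSchwartz (n := n) 0) ((2 : ℝ) ^ k • y) := fun y ↦ by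
    unfold weight
    rw [kernelSchwartz_scaling, fderiv_kernelSchwartz_scaling, norm_smul, norm_smul, norm_smul,
      Real.norm_of_nonneg (by positivity), Real.norm_of_nonneg (by positivity),
      Real.norm_of_nonneg (by positivity)]
    ring
  simp_rw [h]
  rw [integral_const_mul, Measure.integral_comp_smul, finrank_euclideanSpace, Fintype.card_fin,
    abs_of_pos (by positivity), smul_eq_mul, mul_inv_cancel_left₀ (by positivity)]

theorem integral_norm_kernelSchwartz_le (hχ : IsCutoff χ) (k : ℕ) :
    ∫ y, ‖hχ.kernelSchwartz (n := n) k y‖ ≤ ∫ y, weight (hχ.kernelSchwartz (n := n) 0) y := by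
  rw [← hχ.integral_weight_kernelSchwartz k]
  refine integral_mono (hχ.kernelSchwartz (n := n) k).integrable.norm (integrable_weight _) fun y ↦ ?_
  exact le_add_of_nonneg_right (by positivity)

end IsCutoff

/-- `S_k a` is a mollification of `a`. -/
theorem SFun_eq_mollify (hχ : IsCutoff χ) (k : ℕ) (a : EuclideanSpace ℝ (Fin n) → ℂ) :
    SFun χ k a = mollify a (hχ.kernelSchwartz (n := n) k) := by
  ext x
  simp only [SFun, mollify, not_lt.2 (Int.natCast_nonneg k), if_false]
  rw [← integral_sub_left_eq_self _ volume x, hχ.kernel_eq (Int.natCast_nonneg k)]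
  simp [mul_comm]

theorem SFun_of_neg {k : ℤ} (hk : k < 0) (a : EuclideanSpace ℝ (Fin n) → ℂ) :
    SFun χ k a = fun _ ↦ 0 := by
  ext x
  simp [SFun, hk]

theorem hasTemperateGrowth_SFun (hχ : IsCutoff χ) {a : EuclideanSpace ℝ (Fin n) → ℂ}
    (ha : IsLip a) (k : ℤ) : (SFun χ k a).HasTemperateGrowth := by
  rcases lt_or_ge k 0 with hk | hk
  · rw [SFun_of_neg hk]; exact .const 0
  · lift k to ℕ using hk
    obtain ⟨M, hM⟩ := ha.bounded
    obtain ⟨K, hK⟩ := ha.lipschitz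
    rw [SFun_eq_mollify hχ]
    exact hasTemperateGrowth_mollify hK.continuous.aestronglyMeasurable hM _

theorem exists_norm_SFun_le (hχ : IsCutoff χ) {a : EuclideanSpace ℝ (Fin n) → ℂ}
    (ha : IsLip a) : ∃ C : ℝ, ∀ (k : ℤ) x, ‖SFun χ k a x‖ ≤ C := by
  obtain ⟨M, hM⟩ := ha.bounded
  have hM0 : 0 ≤ M := (norm_nonneg _).trans (hM 0)
  have hw : 0 ≤ ∫ y, weight (hχ.kernelSchwartz (n := n) 0) y :=
    integral_nonneg fun y ↦ weight_nonneg _ y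
  refine ⟨M * ∫ y, weight (hχ.kernelSchwartz (n := n) 0) y, fun k x ↦ ?_⟩
  rcases lt_or_ge k 0 with hk | hk
  · rw [SFun_of_neg hk]
    simpa using by positivity
  · lift k to ℕ using hk
    rw [SFun_eq_mollify hχ]
    refine (norm_mollify_le hM _ x).trans ?_
    refine mul_le_mul_of_nonneg_left ?_ (by assumption)
    exact hχ.integral_norm_kernelSchwartz_le k

/-- Mollification does not increase the gradient by more than a constant factor, uniformly in `k`. -/
theorem norm_fderiv_SFun_le (hχ : IsCutoff χ) {a : EuclideanSpace ℝ (Fin n) → ℂ}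
    (ha : IsLip a) {L : ℝ} (hL : 0 ≤ L) (hae : ∀ᵐ x, ‖fderiv ℝ a x‖ ≤ L) (k : ℤ)
    (x : EuclideanSpace ℝ (Fin n)) :
    ‖fderiv ℝ (SFun χ k a) x‖ ≤ L * ∫ y, weight (hχ.kernelSchwartz (n := n) 0) y := by
  have hw : 0 ≤ ∫ y, weight (hχ.kernelSchwartz (n := n) 0) y :=
    integral_nonneg fun y ↦ weight_nonneg _ y
  rcases lt_or_ge k 0 with hk | hk
  · rw [SFun_of_neg hk]
    simpa using by positivity
  · lift k to ℕ using hk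
    obtain ⟨M, hM⟩ := ha.bounded
    obtain ⟨K, hK⟩ := ha.lipschitz
    rw [SFun_eq_mollify hχ]
    refine (norm_fderiv_mollify_le hM hK hL hae _ x).trans ?_
    refine mul_le_mul_of_nonneg_left ?_ (by assumption)
    exact hχ.integral_norm_kernelSchwartz_le k

end Kernel

/-! ### Young's inequality -/

section Young

variable {E : Type*} [NormedAddCommGroup E] [InnerProductSpace ℝ E] [FiniteDimensional ℝ E]
  [MeasurableSpace E] [BorelSpace E]

/-- The Cauchy-Schwarz inequality with respect to the measure with density `k`. -/
theorem sq_lintegral_mul_le {k p : E → ℝ≥0∞} (hk : Measurable k) (hp : Measurable p) :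
    (∫⁻ t, k t * p t) ^ 2 ≤ (∫⁻ t, k t) * ∫⁻ t, k t * p t ^ 2 := by
  have h := ENNReal.lintegral_mul_le_Lp_mul_Lq (volume : Measure E) Real.HolderConjugate.two_two
    (f := fun t ↦ k t ^ (1 / 2 : ℝ)) (g := fun t ↦ k t ^ (1 / 2 : ℝ) * p t)
    (hk.pow_const _).aemeasurable ((hk.pow_const _).mul hp).aemeasurable
  have hs : ∀ x : ℝ≥0∞, x ^ (1 / 2 : ℝ) * x ^ (1 / 2 : ℝ) = x := fun x ↦ by
    rw [← ENNReal.rpow_add_of_nonneg _ _ (by norm_num) (by norm_num)]; norm_num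
  have hs2 : ∀ x : ℝ≥0∞, (x ^ (1 / 2 : ℝ)) ^ 2 = x := fun x ↦ by rw [sq, hs]
  simp only [Pi.mul_apply, ← mul_assoc, hs, ENNReal.rpow_two, mul_pow, hs2] at h
  calc _ ≤ _ := pow_le_pow_left' h 2
    _ = _ := by rw [mul_pow, hs2, hs2]

/-- Young's inequality `L¹ * L² → L²` for nonnegative functions. -/
theorem lintegral_sq_convolution_le {k p : E → ℝ≥0∞} (hk : Measurable k) (hp : Measurable p) :
    ∫⁻ x, (∫⁻ t, k t * p (x - t)) ^ 2 ≤ (∫⁻ t, k t) ^ 2 * ∫⁻ x, p x ^ 2 := by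
  calc ∫⁻ x, (∫⁻ t, k t * p (x - t)) ^ 2
      ≤ ∫⁻ x, (∫⁻ t, k t) * ∫⁻ t, k t * p (x - t) ^ 2 := by
        refine lintegral_mono fun x ↦ ?_
        exact sq_lintegral_mul_le hk (hp.comp (measurable_const.sub measurable_id))
    _ = (∫⁻ t, k t) * ∫⁻ x, ∫⁻ t, k t * p (x - t) ^ 2 := by
        refine lintegral_const_mul _ (Measurable.lintegral_prod_right' (f := fun q : E × E ↦
          k q.2 * p (q.1 - q.2) ^ 2) ?_)
        exact (hk.comp measurable_snd).mul
          ((hp.comp (measurable_fst.sub measurable_snd)).pow_const 2)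
    _ = (∫⁻ t, k t) * ∫⁻ t, ∫⁻ x, k t * p (x - t) ^ 2 := by
        rw [lintegral_lintegral_swap]
        exact ((hk.comp measurable_snd).mul
          ((hp.comp (measurable_fst.sub measurable_snd)).pow_const 2)).aemeasurable
    _ = (∫⁻ t, k t) * ∫⁻ t, k t * ∫⁻ x, p x ^ 2 := by
        congr 2
        ext t
        rw [lintegral_const_mul (f := fun x ↦ p (x - t) ^ 2) _
          ((hp.comp (measurable_id.sub measurable_const)).pow_const 2),
          lintegral_sub_right_eq_self (fun x ↦ p x ^ 2) t]
    _ = (∫⁻ t, k t) ^ 2 * ∫⁻ x, p x ^ 2 := by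
        rw [lintegral_mul_const _ hk, sq, mul_assoc]

theorem eLpNorm_two_le_of_lintegral_sq_le {f g : E → ℂ} {C : ℝ≥0∞}
    (h : ∫⁻ x, ‖f x‖ₑ ^ 2 ≤ C ^ 2 * ∫⁻ x, ‖g x‖ₑ ^ 2) :
    eLpNorm f 2 volume ≤ C * eLpNorm g 2 volume := by
  have hp : ∀ u : E → ℂ, eLpNorm u 2 volume = (∫⁻ x, ‖u x‖ₑ ^ 2) ^ (1 / 2 : ℝ) := fun u ↦ by
    rw [eLpNorm_eq_lintegral_rpow_enorm_toReal (by norm_num) (by norm_num)]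
    simp only [ENNReal.toReal_ofNat, ENNReal.rpow_two]
  rw [hp, hp]
  refine (ENNReal.rpow_le_rpow h (by norm_num)).trans (le_of_eq ?_)
  rw [ENNReal.mul_rpow_of_nonneg _ _ (by norm_num), ← ENNReal.rpow_natCast, ← ENNReal.rpow_mul]
  norm_num

/-- A Schwartz function that is dominated by the convolution of another one with an integrable
kernel is bounded in `L²` accordingly. -/
theorem norm_toLp_le_of_convolution_bound {w : E → ℝ} (hw0 : ∀ t, 0 ≤ w t) (hw : Integrable w)
    (hwc : Continuous w) {K : ℝ} (hK : 0 ≤ K) (D φ : 𝓢(E, ℂ))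
    (h : ∀ x, ‖D x‖ ≤ K * ∫ t, w t * ‖φ (x - t)‖) :
    ‖D.toLp 2‖ ≤ K * (∫ t, w t) * ‖φ.toLp 2‖ := by
  have hmeas : Measurable fun x ↦ ‖φ x‖ₑ := φ.continuous.measurable.enorm
  have hkm : Measurable fun t ↦ ENNReal.ofReal (w t) := hwc.measurable.ennreal_ofReal
  have h1 : ∀ x, ‖D x‖ₑ ≤ ENNReal.ofReal K * ∫⁻ t, ENNReal.ofReal (w t) * ‖φ (x - t)‖ₑ := fun x ↦ by
    rw [← ofReal_norm]
    refine (ENNReal.ofReal_le_ofReal (h x)).trans (le_of_eq ?_)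
    rw [ENNReal.ofReal_mul hK, ofReal_integral_eq_lintegral_ofReal]
    · simp_rw [ENNReal.ofReal_mul (hw0 _), ofReal_norm]
    · refine hw.mul_bdd (c := SchwartzMap.seminorm ℝ 0 0 φ) ?_ (.of_forall fun t ↦ ?_)
      · exact (φ.continuous.comp (by fun_prop)).norm.aestronglyMeasurable
      · rw [norm_norm]
        exact SchwartzMap.norm_le_seminorm ℝ φ _
    · exact .of_forall fun t ↦ mul_nonneg (hw0 t) (norm_nonneg _)
  have h2 : ∫⁻ x, ‖D x‖ₑ ^ 2 ≤ ENNReal.ofReal (K * ∫ t, w t) ^ 2 * ∫⁻ x, ‖φ x‖ₑ ^ 2 := by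
    calc ∫⁻ x, ‖D x‖ₑ ^ 2
        ≤ ∫⁻ x, ENNReal.ofReal K ^ 2 * (∫⁻ t, ENNReal.ofReal (w t) * ‖φ (x - t)‖ₑ) ^ 2 := by
          refine lintegral_mono fun x ↦ ?_
          rw [← mul_pow]
          exact pow_le_pow_left' (h1 x) 2
      _ = ENNReal.ofReal K ^ 2 * ∫⁻ x, (∫⁻ t, ENNReal.ofReal (w t) * ‖φ (x - t)‖ₑ) ^ 2 :=
          lintegral_const_mul' _ _ (ENNReal.pow_ne_top ENNReal.ofReal_ne_top)
      _ ≤ ENNReal.ofReal K ^ 2 * ((∫⁻ t, ENNReal.ofReal (w t)) ^ 2 * ∫⁻ x, ‖φ x‖ₑ ^ 2) :=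
          mul_le_mul_right (lintegral_sq_convolution_le hkm hmeas) _
      _ = _ := by
          rw [ENNReal.ofReal_mul hK, ofReal_integral_eq_lintegral_ofReal hw (.of_forall hw0),
            mul_pow, mul_assoc]
  have h3 : eLpNorm D 2 volume ≤ ENNReal.ofReal (K * ∫ t, w t) * eLpNorm φ 2 volume :=
    eLpNorm_two_le_of_lintegral_sq_le h2
  have h4 : eLpNorm φ 2 volume ≠ ∞ := (φ.eLpNorm_lt_top 2 volume).ne
  rw [SchwartzMap.norm_toLp, SchwartzMap.norm_toLp]
  refine (ENNReal.toReal_mono (ENNReal.mul_ne_top ENNReal.ofReal_ne_top h4) h3).trans (le_of_eq ?_)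
  rw [ENNReal.toReal_mul, ENNReal.toReal_ofReal (mul_nonneg hK (integral_nonneg hw0))]

end Young

/-! ### The kernel of the commutator -/

section Commutator

variable {E : Type*} [NormedAddCommGroup E] [InnerProductSpace ℝ E] [FiniteDimensional ℝ E]
  [MeasurableSpace E] [BorelSpace E]

/-- For an even symbol, the transposed Fourier multiplier is the Fourier multiplier. -/
theorem fourier_smulLeft_fourierInv {g : E → ℂ} (hg : g.HasTemperateGrowth)
    (heven : ∀ η, g (-η) = g η) (φ : 𝓢(E, ℂ)) :
    𝓕 (SchwartzMap.smulLeftCLM ℂ g (𝓕⁻ φ)) = SchwartzMap.fourierMultiplierCLM ℂ g φ := by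
  ext x
  rw [SchwartzMap.fourierMultiplierCLM_apply, SchwartzMap.fourierInv_coe, SchwartzMap.fourier_coe,
    Real.fourierInv_eq, Real.fourier_eq, ← integral_neg_eq_self]
  congr 1
  ext v
  rw [SchwartzMap.smulLeftCLM_apply_apply hg, SchwartzMap.smulLeftCLM_apply_apply hg, heven,
    inner_neg_left, neg_neg, SchwartzMap.fourierInv_coe, SchwartzMap.fourier_coe,
    Real.fourierInv_eq_fourier_neg, neg_neg]

/-- A Fourier multiplier with Schwartz symbol is a convolution. -/
theorem fourierMultiplier_apply_eq_integral {g : E → ℂ} (hg : g.HasTemperateGrowth) (κ φ : 𝓢(E, ℂ))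
    (hκ : ∀ η, 𝓕 κ η = g η) (x : E) :
    SchwartzMap.fourierMultiplierCLM ℂ g φ x = ∫ y, κ (x - y) * φ y := by
  have h : SchwartzMap.fourierMultiplierCLM ℂ g φ
      = SchwartzMap.convolution (ContinuousLinearMap.mul ℂ ℂ) κ φ := by
    rw [SchwartzMap.fourierMultiplierCLM_apply]
    change _ = 𝓕⁻ (SchwartzMap.pairing (ContinuousLinearMap.mul ℂ ℂ) (𝓕 κ) (𝓕 φ))
    congr 1
    ext η
    simp [hg, hκ]
  rw [h, SchwartzMap.convolution_apply, convolution, ← integral_sub_left_eq_self _ volume x]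
  simp

theorem integrable_translate_mul (κ φ : 𝓢(E, ℂ)) (x : E) :
    Integrable fun y ↦ κ (x - y) * φ y := by
  refine φ.integrable.bdd_mul (c := SchwartzMap.seminorm ℝ 0 0 κ) ?_ (.of_forall fun y ↦ ?_)
  · exact (κ.continuous.comp (by fun_prop)).aestronglyMeasurable
  · exact SchwartzMap.norm_le_seminorm ℝ κ _

/-- The pointwise bound of the commutator of a convolution operator and a multiplication operator
applied to a derivative; the derivative is moved to the kernel by an integration by parts. -/
theorem norm_commutator_lineDeriv_apply_le {g b : E → ℂ} (hg : g.HasTemperateGrowth)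
    (hb : b.HasTemperateGrowth) {M K : ℝ} (hM : ∀ x, ‖b x‖ ≤ M) (hK : ∀ x, ‖fderiv ℝ b x‖ ≤ K)
    (κ φ : 𝓢(E, ℂ)) (hκ : ∀ η, 𝓕 κ η = g η) (v x : E) :
    ‖(SchwartzMap.fourierMultiplierCLM ℂ g (SchwartzMap.smulLeftCLM ℂ b (∂_{v} φ))
        - SchwartzMap.smulLeftCLM ℂ b (SchwartzMap.fourierMultiplierCLM ℂ g (∂_{v} φ))) x‖
      ≤ K * ‖v‖ * ∫ t, (‖κ t‖ + ‖t‖ * ‖fderiv ℝ κ t‖) * ‖φ (x - t)‖ := by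
  have hK0 : 0 ≤ K := (norm_nonneg _).trans (hK 0)
  have hbd : Differentiable ℝ b := hb.1.differentiable (by simp)
  have hκd : Differentiable ℝ κ := κ.differentiable
  -- up to a sign, the commutator at `x` is the integral of `φ` against the derivative of `f`; the
  -- factor `b y - b x`, of size `K |x - y|`, compensates the growth of the derivative of the kernel
  set f : E → ℂ := fun y ↦ κ (x - y) * (b y - b x) with hf
  have hfc : ContDiff ℝ 1 f := by
    refine ((κ.smooth 1).comp (contDiff_const.sub contDiff_id)).mul ((hb.1.of_le ?_).sub
      contDiff_const)
    exact_mod_cast le_top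
  have hfd : ∀ y, fderiv ℝ f y v
      = κ (x - y) * fderiv ℝ b y v - fderiv ℝ κ (x - y) v * (b y - b x) := fun y ↦ by
    have h1 : HasFDerivAt (fun y ↦ κ (x - y)) _ y :=
      (κ.hasFDerivAt (x - y)).comp y ((hasFDerivAt_id y).const_sub x)
    have h2 : HasFDerivAt (fun y ↦ b y - b x) _ y := (hbd y).hasFDerivAt.sub_const (b x)
    have h3 : fderiv ℝ f y = _ := (h1.mul h2).fderiv
    rw [h3]
    simp
    ring
  have hlip : ∀ y, ‖b y - b x‖ ≤ K * ‖x - y‖ := fun y ↦ by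
    rw [norm_sub_rev x y]
    exact Convex.norm_image_sub_le_of_norm_fderiv_le (fun z _ ↦ hbd z) (fun z _ ↦ hK z) convex_univ
      (Set.mem_univ x) (Set.mem_univ y)
  have hfd_le : ∀ y, ‖fderiv ℝ f y v‖
      ≤ K * ‖v‖ * (‖κ (x - y)‖ + ‖x - y‖ * ‖fderiv ℝ κ (x - y)‖) := fun y ↦ by
    rw [hfd]
    have h1 : ‖fderiv ℝ b y v‖ ≤ K * ‖v‖ :=
      (ContinuousLinearMap.le_opNorm _ _).trans (by gcongr; exact hK y)
    have h2 : ‖fderiv ℝ κ (x - y) v‖ ≤ ‖fderiv ℝ κ (x - y)‖ * ‖v‖ :=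
      ContinuousLinearMap.le_opNorm _ _
    calc _ ≤ ‖κ (x - y)‖ * ‖fderiv ℝ b y v‖ + ‖fderiv ℝ κ (x - y) v‖ * ‖b y - b x‖ := by
          rw [← norm_mul, ← norm_mul]; exact norm_sub_le _ _
      _ ≤ ‖κ (x - y)‖ * (K * ‖v‖) + (‖fderiv ℝ κ (x - y)‖ * ‖v‖) * (K * ‖x - y‖) := by
          gcongr
          exact hlip y
      _ = _ := by ring
  obtain ⟨W, hW⟩ : ∃ W : ℝ, ∀ t, ‖κ t‖ + ‖t‖ * ‖fderiv ℝ κ t‖ ≤ W := by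
    refine ⟨SchwartzMap.seminorm ℝ 0 0 κ + SchwartzMap.seminorm ℝ 1 0
      (SchwartzMap.fderivCLM ℝ E ℂ κ), fun t ↦ add_le_add (SchwartzMap.norm_le_seminorm ℝ κ t) ?_⟩
    simpa using SchwartzMap.norm_pow_mul_le_seminorm ℝ (SchwartzMap.fderivCLM ℝ E ℂ κ) 1 t
  have hI1 : Integrable fun y ↦ fderiv ℝ f y v * φ y := by
    refine φ.integrable.bdd_mul (c := K * ‖v‖ * W) ?_ (.of_forall fun y ↦ ?_)
    · exact ((hfc.continuous_fderiv (by simp)).clm_apply continuous_const).aestronglyMeasurable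
    · refine (hfd_le y).trans ?_
      gcongr
      exact hW _
  have hfb : ∀ y, ‖f y‖ ≤ SchwartzMap.seminorm ℝ 0 0 κ * (M + M) := fun y ↦ by
    rw [hf]
    simp only [norm_mul]
    gcongr
    · exact SchwartzMap.norm_le_seminorm ℝ κ _
    · exact (norm_sub_le _ _).trans (add_le_add (hM y) (hM x))
  have hI2 : Integrable fun y ↦ f y * fderiv ℝ φ y v := by
    have : Integrable fun y ↦ fderiv ℝ φ y v := (∂_{v} φ : 𝓢(E, ℂ)).integrable
    exact this.bdd_mul hfc.continuous.aestronglyMeasurable (.of_forall hfb)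
  have hI3 : Integrable fun y ↦ f y * φ y :=
    φ.integrable.bdd_mul hfc.continuous.aestronglyMeasurable (.of_forall hfb)
  have hD : (SchwartzMap.fourierMultiplierCLM ℂ g (SchwartzMap.smulLeftCLM ℂ b (∂_{v} φ))
        - SchwartzMap.smulLeftCLM ℂ b (SchwartzMap.fourierMultiplierCLM ℂ g (∂_{v} φ))) x
      = - ∫ y, fderiv ℝ f y v * φ y := by
    rw [← integral_mul_fderiv_eq_neg_fderiv_mul_of_integrable hI1 hI2 hI3
      (fun y _ ↦ hfc.differentiable (by simp) y) (fun y _ ↦ φ.differentiable y), _root_.sub_apply,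
      SchwartzMap.smulLeftCLM_apply_apply hb, fourierMultiplier_apply_eq_integral hg κ _ hκ,
      fourierMultiplier_apply_eq_integral hg κ _ hκ, smul_eq_mul, ← integral_const_mul,
      ← integral_sub (integrable_translate_mul _ _ x) ((integrable_translate_mul _ _ x).const_mul _)]
    congr 1
    ext y
    rw [SchwartzMap.smulLeftCLM_apply_apply hb, SchwartzMap.lineDerivOp_apply_eq_fderiv, hf]
    simp only [smul_eq_mul]
    ring
  rw [hD, norm_neg, ← integral_sub_left_eq_self _ volume x, ← integral_const_mul]
  refine norm_integral_le_of_norm_le (Integrable.const_mul ?_ _) (.of_forall fun y ↦ ?_)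
  · refine (φ.integrable.norm.comp_sub_left x).bdd_mul (c := W) ?_ (.of_forall fun y ↦ ?_)
    · have h1 : Continuous (fderiv ℝ κ) := (SchwartzMap.fderivCLM ℝ E ℂ κ).continuous
      have := κ.continuous
      exact Continuous.aestronglyMeasurable (by fun_prop)
    · rw [Real.norm_of_nonneg (by positivity)]
      exact hW _
  · have h1 := hfd_le (x - y)
    rw [sub_sub_cancel] at h1
    rw [norm_mul, ← mul_assoc]
    exact mul_le_mul_of_nonneg_right h1 (norm_nonneg _)

end Commutator

/-! ### Frequency localization of products -/

section SpectralLocalization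

variable {E : Type} [NormedAddCommGroup E] [InnerProductSpace ℝ E] [FiniteDimensional ℝ E]
  [MeasurableSpace E] [BorelSpace E]

theorem fourierInv_compSubConst_apply (κ : 𝓢(E, ℂ)) (z t : E) :
    𝓕⁻ (SchwartzMap.compSubConstCLM ℂ z κ) t = Real.fourierChar (inner ℝ z t) • 𝓕⁻ κ t := by
  rw [SchwartzMap.fourierInv_coe, SchwartzMap.fourierInv_coe, Real.fourierInv_eq,
    Real.fourierInv_eq, ← integral_add_right_eq_self _ z, Circle.smul_def, ← integral_smul]
  congr 1
  ext y
  simp [SchwartzMap.compSubConstCLM_apply, inner_add_left, AddChar.map_add_eq_mul, Circle.smul_def]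
  ring

/-- The Fourier transform of a product is the convolution of the Fourier transforms; it vanishes at
`η` if no frequency of the second factor differs from `η` by a frequency of the first one. -/
theorem fourierInv_translate_mul_eq_zero (κ ψ : 𝓢(E, ℂ)) (z η : E)
    (h : ∀ t, 𝓕⁻ κ t ≠ 0 → ψ (η - t) = 0) :
    ∫ y, Real.fourierChar (inner ℝ y η) • (κ (y - z) * 𝓕 ψ y) = 0 := by
  set A : 𝓢(E, ℂ) := 𝓕⁻ (SchwartzMap.compSubConstCLM ℂ z κ) with hA
  have h1 : SchwartzMap.convolution (ContinuousLinearMap.mul ℂ ℂ) A ψ η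
      = ∫ y, Real.fourierChar (inner ℝ y η) • (κ (y - z) * 𝓕 ψ y) := by
    change 𝓕⁻ (SchwartzMap.pairing (ContinuousLinearMap.mul ℂ ℂ) (𝓕 A) (𝓕 ψ)) η = _
    rw [SchwartzMap.fourierInv_coe, Real.fourierInv_eq, hA, FourierTransform.fourier_fourierInv_eq]
    congr 1
  rw [← h1, SchwartzMap.convolution_apply, convolution]
  refine integral_eq_zero_of_ae (.of_forall fun t ↦ ?_)
  by_cases ht : 𝓕⁻ κ t = 0
  · simp [hA, fourierInv_compSubConst_apply, ht]
  · simp [h t ht]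

/-- The product of a mollified function and of a Schwartz function has no frequencies outside of the
sum of the two sets of frequencies. -/
theorem fourierInv_mollify_mul_eq_zero {a : E → ℂ} {M : ℝ} (ha : AEStronglyMeasurable a)
    (hM : ∀ x, ‖a x‖ ≤ M) (κ ψ : 𝓢(E, ℂ)) (η : E) (h : ∀ t, 𝓕⁻ κ t ≠ 0 → ψ (η - t) = 0) :
    𝓕⁻ (SchwartzMap.smulLeftCLM ℂ (mollify a κ) (𝓕 ψ)) η = 0 := by
  have hm := hasTemperateGrowth_mollify ha hM κ
  set φ : 𝓢(E, ℂ) := 𝓕 ψ with hφ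
  rw [SchwartzMap.fourierInv_coe, Real.fourierInv_eq]
  have h1 : ∀ y, Real.fourierChar (inner ℝ y η) • SchwartzMap.smulLeftCLM ℂ (mollify a κ) φ y
      = ∫ z, a z * (Real.fourierChar (inner ℝ y η) • (κ (y - z) * φ y)) := fun y ↦ by
    rw [SchwartzMap.smulLeftCLM_apply_apply hm, mollify, smul_eq_mul, Circle.smul_def, smul_eq_mul,
      ← integral_mul_const, ← integral_const_mul]
    congr 1
    ext z
    simp only [smul_eq_mul, Circle.smul_def]
    ring
  simp_rw [h1]
  rw [integral_integral_swap]
  · refine integral_eq_zero_of_ae (.of_forall fun z ↦ ?_)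
    change ∫ y, a z * (Real.fourierChar (inner ℝ y η) • (κ (y - z) * φ y)) = 0
    rw [integral_const_mul, hφ, fourierInv_translate_mul_eq_zero κ ψ z η h, mul_zero]
  · have hint : Integrable (fun p : E × E ↦ κ (p.1 - p.2) * φ p.1) (volume.prod volume) := by
      have h2 := (φ.integrable (μ := volume)).convolution_integrand (ContinuousLinearMap.mul ℂ ℂ)
        (κ.integrable (μ := volume)).comp_neg
      refine h2.swap.congr (.of_forall fun p ↦ ?_)
      simp [mul_comm]
    refine (hint.bdd_mul (c := M) (f := fun p : E × E ↦
      a p.2 * (Real.fourierChar (inner ℝ p.1 η) : ℂ)) ?_ (.of_forall fun p ↦ ?_)).congr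
      (.of_forall fun p ↦ ?_)
    · refine (ha.comp_snd).mul ?_
      have : Continuous fun p : E × E ↦ (Real.fourierChar (inner ℝ p.1 η) : ℂ) :=
        continuous_subtype_val.comp (Real.continuous_fourierChar.comp (by fun_prop))
      exact this.aestronglyMeasurable
    · rw [norm_mul, Circle.norm_coe, mul_one]
      exact hM p.2
    · simp [Function.uncurry, Circle.smul_def]
      ring

end SpectralLocalization

section Blocks

variable {n : ℕ} {χ : ℝ → ℝ}

/-- `Δ_k (S_c a · Δ_ν φ) = 0` if the frequencies of the three factors do not interact. -/
theorem smulLeft_fourierInv_SFun_mul_eq_zero (hχ : IsCutoff χ)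
    {a : EuclideanSpace ℝ (Fin n) → ℂ} (ha : IsLip a) (c : ℤ) {k ν : ℕ}
    (h : ∀ ξ ζ : EuclideanSpace ℝ (Fin n), blockSymbol χ k ξ ≠ 0 → lowSymbol χ c ζ ≠ 0 →
      blockSymbol χ ν (ξ - ζ) = 0) (ψ : 𝓢(EuclideanSpace ℝ (Fin n), ℂ)) :
    SchwartzMap.smulLeftCLM ℂ (blockSymbol χ k) (𝓕⁻ (SchwartzMap.smulLeftCLM ℂ (SFun χ c a)
      (𝓕 (SchwartzMap.smulLeftCLM ℂ (blockSymbol χ ν) ψ)))) = 0 := by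
  ext η
  rw [SchwartzMap.smulLeftCLM_apply_apply (hχ.hasTemperateGrowth_blockSymbol k)]
  by_cases hη : blockSymbol χ k η = 0
  · simp [hη]
  have : 𝓕⁻ (SchwartzMap.smulLeftCLM ℂ (SFun χ c a)
      (𝓕 (SchwartzMap.smulLeftCLM ℂ (blockSymbol χ ν) ψ))) η = 0 := by
    rcases lt_or_ge c 0 with hc | hc
    · rw [SFun_of_neg hc, SchwartzMap.smulLeftCLM_const, zero_smul, _root_.zero_apply]
      exact congrArg (fun f : 𝓢(EuclideanSpace ℝ (Fin n), ℂ) ↦ f η)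
        (map_zero (fourierInvCLM ℂ 𝓢(EuclideanSpace ℝ (Fin n), ℂ)))
    · lift c to ℕ using hc
      obtain ⟨M, hM⟩ := ha.bounded
      obtain ⟨K, hK⟩ := ha.lipschitz
      rw [SFun_eq_mollify hχ]
      refine fourierInv_mollify_mul_eq_zero hK.continuous.aestronglyMeasurable hM _ _ η fun t ht ↦ ?_
      rw [SchwartzMap.smulLeftCLM_apply_apply (hχ.hasTemperateGrowth_blockSymbol ν), h η t hη,
        zero_smul]
      refine fun h0 ↦ ht ?_
      -- `𝓕⁻ 𝓕⁻` is the reflection, and the symbol is even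
      rw [SchwartzMap.fourierInv_coe, Real.fourierInv_eq_fourier_neg, ← SchwartzMap.fourier_coe,
        IsCutoff.kernelSchwartz, FourierTransform.fourier_fourierInv_eq, IsCutoff.lowSchwartz_apply,
        lowSymbol_even, h0]
  rw [this, smul_zero, _root_.zero_apply]

/-- The frequencies of `S_c a`, `c = max (m - 1) (k - 3)`, do not move the frequencies of `Δ_k` to
those of `Δ_ν` if `|k - ν| ≥ m + 5`. -/
theorem blockSymbol_sub_eq_zero (hχ : IsCutoff χ) {m k ν : ℕ} (h : k + m + 5 ≤ ν ∨ ν + m + 5 ≤ k)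
    (ξ ζ : EuclideanSpace ℝ (Fin n)) (hξ : blockSymbol χ k ξ ≠ 0)
    (hζ : lowSymbol χ (max ((m : ℤ) - 1) ((k : ℤ) - 3)) ζ ≠ 0) : blockSymbol χ ν (ξ - ζ) = 0 := by
  have h1 : freq ξ ≤ 19 / 10 * 2 ^ k := by
    by_contra hcon
    exact hξ (hχ.blockSymbol_eq_zero_of_ge (not_le.1 hcon).le)
  have h2 : freq ζ ≤ 19 / 10 * 2 ^ (max ((m : ℤ) - 1) ((k : ℤ) - 3)) := by
    by_contra hcon
    exact hζ (hχ.lowSymbol_eq_zero (not_le.1 hcon).le)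
  rcases h with h | h
  · refine hχ.blockSymbol_eq_zero_of_le (by omega) ?_
    have h3 : freq (ξ - ζ) ≤ freq ξ + freq ζ := by
      rw [sub_eq_add_neg, ← freq_neg ζ]; exact freq_add_le _ _
    have h4 : (2 : ℝ) ^ (max ((m : ℤ) - 1) ((k : ℤ) - 3)) ≤ 2 ^ ((ν : ℤ) - 5) :=
      zpow_le_zpow_right₀ (by norm_num) (by omega)
    have h5 : (2 : ℝ) ^ (k : ℤ) ≤ 2 ^ ((ν : ℤ) - 5) :=
      zpow_le_zpow_right₀ (by norm_num) (by omega)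
    rw [zpow_sub₀ (by norm_num)] at h4 h5
    norm_num at h4 h5
    have : (0 : ℝ) < 2 ^ ν := by positivity
    linarith
  · refine hχ.blockSymbol_eq_zero_of_ge ?_
    have h0 : 11 / 20 * 2 ^ k ≤ freq ξ := by
      by_contra hcon
      exact hξ (hχ.blockSymbol_eq_zero_of_le (by omega) (not_le.1 hcon).le)
    have h3 : freq ξ ≤ freq (ξ - ζ) + freq ζ := by
      simpa using freq_add_le (ξ - ζ) ζ
    have h4 : (2 : ℝ) ^ (max ((m : ℤ) - 1) ((k : ℤ) - 3)) ≤ 2 ^ ((k : ℤ) - 3) :=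
      zpow_le_zpow_right₀ (by norm_num) (by omega)
    have h5 : (2 : ℝ) ^ (ν : ℤ) ≤ 2 ^ ((k : ℤ) - 5) :=
      zpow_le_zpow_right₀ (by norm_num) (by omega)
    rw [zpow_sub₀ (by norm_num)] at h4 h5
    norm_num at h4 h5
    have : (0 : ℝ) < 2 ^ k := by positivity
    linarith

/-- `Δ_k Δ_ν = 0` unless `|k - ν| ≤ 1`. -/
theorem blockSymbol_mul_eq_zero (hχ : IsCutoff χ) {k ν : ℕ} (h : k + 2 ≤ ν)
    (η : EuclideanSpace ℝ (Fin n)) : blockSymbol χ k η * blockSymbol χ ν η = 0 := by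
  have h5 : (2 : ℝ) ^ (k : ℤ) ≤ 2 ^ ((ν : ℤ) - 2) :=
    zpow_le_zpow_right₀ (by norm_num) (by omega)
  rw [zpow_sub₀ (by norm_num)] at h5
  norm_num at h5
  have : (0 : ℝ) < 2 ^ ν := by positivity
  rcases le_total (freq η) (11 / 20 * 2 ^ ν) with h1 | h1
  · rw [hχ.blockSymbol_eq_zero_of_le (by omega) h1, mul_zero]
  · rw [hχ.blockSymbol_eq_zero_of_ge (by linarith), zero_mul]

end Blocks

/-! ### Sobolev norms and the blocks -/

section Sobolev

variable {n : ℕ} {χ : ℝ → ℝ}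

/-- The symbol `(1 + |ξ|²)^{σ/2}` in the frequency variable of Mathlib's Fourier transform. -/
noncomputable def besselWeight (σ : ℝ) (η : EuclideanSpace ℝ (Fin n)) : ℂ :=
  (((1 + ‖(2 * Real.pi) • η‖ ^ 2) ^ (σ / 2) : ℝ) : ℂ)

theorem hasTemperateGrowth_besselWeight (σ : ℝ) :
    (besselWeight (n := n) σ).HasTemperateGrowth := by
  have h1 : (fun η : EuclideanSpace ℝ (Fin n) ↦ (2 * Real.pi) • η).HasTemperateGrowth := by
    fun_prop
  exact (Function.Complex.hasTemperateGrowth_ofReal.comp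
    (Function.hasTemperateGrowth_one_add_norm_sq_rpow (EuclideanSpace ℝ (Fin n)) (σ / 2))).comp h1

theorem norm_besselWeight (σ : ℝ) (η : EuclideanSpace ℝ (Fin n)) :
    ‖besselWeight σ η‖ = (1 + freq η ^ 2) ^ (σ / 2) := by
  rw [besselWeight, Complex.norm_real, Real.norm_of_nonneg (by positivity), norm_two_pi_smul]

theorem besselWeight_mul_neg (σ : ℝ) (η : EuclideanSpace ℝ (Fin n)) :
    besselWeight σ η * besselWeight (-σ) η = 1 := by
  rw [besselWeight, besselWeight, ← Complex.ofReal_mul, ← Real.rpow_add (by positivity)]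
  simp [neg_div]

/-- `MemSobolev` provides an `L²` function that represents `(1 + |D|²)^{σ/2} u`: Mathlib's Bessel
potential differs from this operator by a rescaling of the frequency only. -/
theorem exists_lp_of_memSobolev {σ : ℝ} (hσ : 0 ≤ σ) {u : 𝓢'(EuclideanSpace ℝ (Fin n), ℂ)}
    (hu : MemSobolev σ 2 u) : ∃ f : Lp ℂ 2 (volume : Measure (EuclideanSpace ℝ (Fin n))),
      Lp.toTemperedDistribution f = fourierMultiplierCLM ℂ (besselWeight σ) u := by
  obtain ⟨f', hf'⟩ := hu
  set b : ℝ → EuclideanSpace ℝ (Fin n) → ℂ := fun σ x ↦ ((1 + ‖x‖ ^ 2) ^ (σ / 2) : ℝ) with hb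
  have hbt : ∀ σ, (b σ).HasTemperateGrowth := fun σ ↦
    Function.Complex.hasTemperateGrowth_ofReal.comp
      (Function.hasTemperateGrowth_one_add_norm_sq_rpow (EuclideanSpace ℝ (Fin n)) (σ / 2))
  have hbound : ∀ x, ‖(b (-σ) * besselWeight σ : EuclideanSpace ℝ (Fin n) → ℂ) x‖
      ≤ ((2 * Real.pi) ^ 2) ^ (σ / 2) := fun x ↦ by
    have h1 : 1 + freq x ^ 2 ≤ (2 * Real.pi) ^ 2 * (1 + ‖x‖ ^ 2) := by
      have : (1 : ℝ) ≤ (2 * Real.pi) ^ 2 := by nlinarith [Real.pi_gt_three]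
      rw [freq]
      nlinarith
    rw [Pi.mul_apply, norm_mul, norm_besselWeight, hb]
    simp only [Complex.norm_real]
    rw [Real.norm_of_nonneg (by positivity), neg_div, Real.rpow_neg (by positivity),
      inv_mul_le_iff₀ (by positivity), mul_comm, ← Real.mul_rpow (by positivity) (by positivity)]
    have := sq_nonneg (freq x)
    exact Real.rpow_le_rpow (by positivity) h1 (by positivity)
  obtain ⟨F, hF, -⟩ := exists_lp_fourierMultiplier
    ((hbt (-σ)).mul (hasTemperateGrowth_besselWeight σ)) hbound f'
  refine ⟨F, ?_⟩
  have h2 : besselPotential _ ℂ σ u = fourierMultiplierCLM ℂ (b σ) u := rfl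
  rw [hF, ← hf', h2, fourierMultiplierCLM_fourierMultiplierCLM_apply (hbt σ)
    ((hbt (-σ)).mul (hasTemperateGrowth_besselWeight σ))]
  congr 2
  ext x
  have h3 : b σ x * b (-σ) x = 1 := by
    rw [hb]
    simp only
    rw [← Complex.ofReal_mul, ← Real.rpow_add (by positivity)]
    simp [neg_div]
  rw [Pi.mul_apply, Pi.mul_apply, ← mul_assoc, h3, one_mul]

/-- The `L²` norm of the Littlewood-Paley block `Δ_k f`, computed on the Fourier side. -/
noncomputable def blockNorm (χ : ℝ → ℝ) (f : Lp ℂ 2 (volume : Measure (EuclideanSpace ℝ (Fin n))))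
    (k : ℕ) : ℝ≥0∞ :=
  eLpNorm (fun η ↦ blockSymbol χ k η *
    (𝓕 f : Lp ℂ 2 (volume : Measure (EuclideanSpace ℝ (Fin n)))) η) 2 volume

theorem eLpNorm_two_sq (g : EuclideanSpace ℝ (Fin n) → ℂ) :
    eLpNorm g 2 volume ^ 2 = ∫⁻ x, ‖g x‖ₑ ^ 2 := by
  rw [eLpNorm_eq_lintegral_rpow_enorm_toReal (by norm_num) (by norm_num), ← ENNReal.rpow_natCast,
    ← ENNReal.rpow_mul]
  simp

/-- Almost orthogonality of the blocks. -/
theorem tsum_blockNorm_sq_le (hχ : IsCutoff χ)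
    (f : Lp ℂ 2 (volume : Measure (EuclideanSpace ℝ (Fin n)))) :
    ∑' k, blockNorm χ f k ^ 2 ≤ ‖f‖ₑ ^ 2 := by
  set g : Lp ℂ 2 (volume : Measure (EuclideanSpace ℝ (Fin n))) := 𝓕 f with hg
  have hfg : ‖f‖ₑ = ‖g‖ₑ := ((Lp.fourierTransformₗᵢ _ ℂ).enorm_map f).symm
  have hmeas : ∀ k, AEMeasurable fun η : EuclideanSpace ℝ (Fin n) ↦ ‖blockSymbol χ k η * g η‖ₑ ^ 2 :=
    fun k ↦ ((((hχ.hasTemperateGrowth_blockSymbol k).1.continuous.aestronglyMeasurable).mul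
      (Lp.aestronglyMeasurable g)).enorm).pow_const 2
  calc ∑' k, blockNorm χ f k ^ 2 = ∑' k, ∫⁻ η, ‖blockSymbol χ k η * g η‖ₑ ^ 2 := by
        simp_rw [blockNorm, eLpNorm_two_sq, hg]
    _ = ∫⁻ η, ∑' k, ‖blockSymbol χ k η * g η‖ₑ ^ 2 := (lintegral_tsum hmeas).symm
    _ ≤ ∫⁻ η, ‖g η‖ₑ ^ 2 := by
        refine lintegral_mono fun η ↦ ENNReal.tsum_le_of_sum_range_le fun K ↦ ?_
        simp_rw [enorm_mul, mul_pow]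
        rw [← Finset.sum_mul]
        refine mul_le_of_le_one_left zero_le ?_
        have h := ENNReal.ofReal_le_ofReal (hχ.sum_norm_blockSymbol_sq_le K η)
        rw [ENNReal.ofReal_sum_of_nonneg fun _ _ ↦ by positivity, ENNReal.ofReal_one] at h
        simpa only [ENNReal.ofReal_pow (norm_nonneg _), ofReal_norm] using h
    _ = ‖f‖ₑ ^ 2 := by rw [hfg, Lp.enorm_def, eLpNorm_two_sq]

theorem blockNorm_le (hχ : IsCutoff χ) (f : Lp ℂ 2 (volume : Measure (EuclideanSpace ℝ (Fin n))))
    (k : ℕ) : blockNorm χ f k ≤ ‖f‖ₑ :=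
  (ENNReal.pow_le_pow_left_iff two_ne_zero).1
    ((ENNReal.le_tsum k).trans (tsum_blockNorm_sq_le hχ f))

variable {σ : ℝ} {u : 𝓢'(EuclideanSpace ℝ (Fin n), ℂ)}
  {f : Lp ℂ 2 (volume : Measure (EuclideanSpace ℝ (Fin n)))}

/-- For `f = (1 + |D|²)^{σ/2} u`, a multiplier `g` with `(1 + |ξ|²)^{-σ/2} |g|` at most `c` times the
symbol of `Δ_k` maps `u` to `L²`, with norm at most `c ‖Δ_k f‖`. -/
theorem exists_lp_multiplier_of_le (hχ : IsCutoff χ)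
    (hf : Lp.toTemperedDistribution f = fourierMultiplierCLM ℂ (besselWeight σ) u)
    {g : EuclideanSpace ℝ (Fin n) → ℂ} (hg : g.HasTemperateGrowth) {c : ℝ} (hc : 0 ≤ c) {k : ℕ}
    (h : ∀ η, ‖besselWeight (-σ) η * g η‖ ≤ c * ‖blockSymbol χ k η‖) :
    ∃ F : Lp ℂ 2 (volume : Measure (EuclideanSpace ℝ (Fin n))),
      Lp.toTemperedDistribution F = fourierMultiplierCLM ℂ g u ∧
      ‖F‖ ≤ c * (blockNorm χ f k).toReal := by
  have hb := hasTemperateGrowth_besselWeight (n := n)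
  have hbd : ∀ η, ‖(besselWeight (-σ) * g : EuclideanSpace ℝ (Fin n) → ℂ) η‖ ≤ c := fun η ↦
    (h η).trans (mul_le_of_le_one_right hc (hχ.norm_blockSymbol_le_one k η))
  obtain ⟨F, hF, hn⟩ := exists_lp_fourierMultiplier ((hb (-σ)).mul hg) hbd f
  refine ⟨F, ?_, ?_⟩
  · rw [hF, hf, fourierMultiplierCLM_fourierMultiplierCLM_apply (hb σ) ((hb (-σ)).mul hg)]
    congr 2
    ext η
    rw [Pi.mul_apply, Pi.mul_apply, ← mul_assoc, besselWeight_mul_neg, one_mul]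
  · have h1 : ‖F‖ₑ ≤ ENNReal.ofReal c * blockNorm χ f k := by
      rw [hn]
      refine eLpNorm_le_mul_eLpNorm_of_ae_le_mul (.of_forall fun η ↦ ?_) 2
      rw [norm_mul, norm_mul, ← mul_assoc]
      exact mul_le_mul_of_nonneg_right (h η) (norm_nonneg _)
    have hfin : blockNorm χ f k ≠ ∞ := ((blockNorm_le hχ f k).trans_lt enorm_lt_top).ne
    have h2 := ENNReal.toReal_mono (ENNReal.mul_ne_top ENNReal.ofReal_ne_top hfin) h1
    rwa [toReal_enorm, ENNReal.toReal_mul, ENNReal.toReal_ofReal hc] at h2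

/-- The symbol of `∂_h`. -/
theorem partialD_eq (h : Fin n) (u : 𝓢'(EuclideanSpace ℝ (Fin n), ℂ)) :
    partialD h u = fourierMultiplierCLM ℂ ((2 * Real.pi * Complex.I) •
      fun η : EuclideanSpace ℝ (Fin n) ↦ ((inner ℝ η (EuclideanSpace.single h (1 : ℝ)) : ℝ) : ℂ)) u := by
  rw [fourierMultiplierCLM_smul (by fun_prop), partialD, lineDeriv_eq_fourierMultiplierCLM]
  rfl

/-- `‖Δ_k ∂_h u‖ ≲ 2^{ks} ‖Δ_k f‖` for `f = (1 + |D|²)^{(1-s)/2} u`. -/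
theorem exists_lp_block_partialD (hχ : IsCutoff χ) {s : ℝ} (hs : s ∈ Set.Ioo (0 : ℝ) 1)
    (hf : Lp.toTemperedDistribution f = fourierMultiplierCLM ℂ (besselWeight (1 - s)) u)
    (h : Fin n) (k : ℕ) : ∃ F : Lp ℂ 2 (volume : Measure (EuclideanSpace ℝ (Fin n))),
      Lp.toTemperedDistribution F = Block χ k (partialD h u) ∧
      ‖F‖ ≤ 3 * 2 ^ (k * s) * (blockNorm χ f k).toReal := by
  set d : EuclideanSpace ℝ (Fin n) → ℂ := (2 * Real.pi * Complex.I) •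
      fun η : EuclideanSpace ℝ (Fin n) ↦ ((inner ℝ η (EuclideanSpace.single h (1 : ℝ)) : ℝ) : ℂ)
    with hd
  have hdt : d.HasTemperateGrowth := by rw [hd]; fun_prop
  have hbt := hχ.hasTemperateGrowth_blockSymbol (n := n) k
  rw [hχ.block_eq, partialD_eq, fourierMultiplierCLM_fourierMultiplierCLM_apply hdt hbt]
  refine exists_lp_multiplier_of_le hχ hf (hdt.mul hbt) (by positivity) fun η ↦ ?_
  rw [Pi.mul_apply, ← mul_assoc, norm_mul]
  rcases le_or_gt (19 / 10 * 2 ^ k) (freq η) with hη | hη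
  · simp [hχ.blockSymbol_eq_zero_of_ge hη]
  refine mul_le_mul_of_nonneg_right ?_ (norm_nonneg _)
  have hf0 := freq_nonneg η
  have h1 : ‖d η‖ ≤ (1 + freq η ^ 2) ^ (1 / 2 : ℝ) := by
    have h2 : ‖d η‖ ≤ freq η := by
      have h3 : |inner ℝ η (EuclideanSpace.single h (1 : ℝ))| ≤ ‖η‖ := by
        simpa using abs_real_inner_le_norm η (EuclideanSpace.single h (1 : ℝ))
      rw [hd, Pi.smul_apply, norm_smul, Complex.norm_real, Real.norm_eq_abs, freq]
      have h4 : ‖(2 * Real.pi * Complex.I : ℂ)‖ = 2 * Real.pi := by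
        simp [abs_of_pos Real.pi_pos]
      rw [h4]
      gcongr
    refine h2.trans ?_
    rw [← Real.sqrt_eq_rpow]
    exact Real.le_sqrt_of_sq_le (by linarith)
  have h5 : 1 + freq η ^ 2 ≤ 5 * (4 : ℝ) ^ k := by
    have h6 : (4 : ℝ) ^ k = (2 ^ k) ^ 2 := by rw [← pow_mul, mul_comm, pow_mul]; norm_num
    have h7 : (1 : ℝ) ≤ 4 ^ k := one_le_pow₀ (by norm_num)
    have h8 : freq η ^ 2 ≤ (19 / 10 * 2 ^ k) ^ 2 := by gcongr
    rw [h6] at *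
    nlinarith
  rw [norm_mul, norm_besselWeight]
  calc (1 + freq η ^ 2) ^ (-(1 - s) / 2) * ‖d η‖
      ≤ (1 + freq η ^ 2) ^ (-(1 - s) / 2) * (1 + freq η ^ 2) ^ (1 / 2 : ℝ) := by gcongr
    _ = (1 + freq η ^ 2) ^ (s / 2) := by
        rw [← Real.rpow_add (by positivity)]; congr 1; ring
    _ ≤ (5 * (4 : ℝ) ^ k) ^ (s / 2) :=
        Real.rpow_le_rpow (by positivity) h5 (by linarith [hs.1])
    _ = 5 ^ (s / 2) * 2 ^ (k * s) := by
        rw [Real.mul_rpow (by norm_num) (by positivity)]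
        congr 1
        rw [show (4 : ℝ) = 2 ^ (2 : ℝ) by norm_num, ← Real.rpow_natCast, ← Real.rpow_mul (by norm_num),
          ← Real.rpow_mul (by norm_num)]
        congr 1
        ring
    _ ≤ 3 * 2 ^ (k * s) := by
        gcongr
        calc (5 : ℝ) ^ (s / 2) ≤ 9 ^ (s / 2) := by gcongr; linarith [hs.1]; norm_num
          _ ≤ 9 ^ (1 / 2 : ℝ) := by gcongr; norm_num; linarith [hs.2]
          _ = 3 := by
            rw [← Real.sqrt_eq_rpow, show (9 : ℝ) = 3 ^ 2 by norm_num, Real.sqrt_sq (by norm_num)]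

/-- `‖Δ_k u‖ ≲ 2^{-kσ} ‖f‖` for `f = (1 + |D|²)^{σ/2} u`. -/
theorem exists_lp_block (hχ : IsCutoff χ) (hσ : 0 ≤ σ) (hσ1 : σ ≤ 1)
    (hf : Lp.toTemperedDistribution f = fourierMultiplierCLM ℂ (besselWeight σ) u) (k : ℕ) :
    ∃ F : Lp ℂ 2 (volume : Measure (EuclideanSpace ℝ (Fin n))),
      Lp.toTemperedDistribution F = Block χ k u ∧ ‖F‖ ≤ 2 * (2 ^ (-σ)) ^ k * ‖f‖ := by
  have hbt := hχ.hasTemperateGrowth_blockSymbol (n := n) k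
  suffices hle : ∀ η : EuclideanSpace ℝ (Fin n),
      ‖besselWeight (-σ) η * blockSymbol χ k η‖ ≤ 2 * (2 ^ (-σ)) ^ k * ‖blockSymbol χ k η‖ by
    obtain ⟨F, hF, hn⟩ := exists_lp_multiplier_of_le hχ hf hbt (by positivity) hle
    refine ⟨F, by rw [hF, hχ.block_eq], hn.trans ?_⟩
    gcongr
    have := ENNReal.toReal_mono enorm_ne_top (blockNorm_le hχ f k)
    rwa [toReal_enorm] at this
  intro η
  rw [norm_mul, norm_besselWeight]
  by_cases hη : blockSymbol χ k η = 0
  · simp [hη]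
  refine mul_le_mul_of_nonneg_right ?_ (norm_nonneg _)
  have hf0 := freq_nonneg η
  have h1 : (4 : ℝ) ^ k / 4 ≤ 1 + freq η ^ 2 := by
    rcases Nat.eq_zero_or_pos k with rfl | hk
    · norm_num; nlinarith
    · have h2 : 11 / 20 * 2 ^ k ≤ freq η := by
        by_contra hcon
        exact hη (hχ.blockSymbol_eq_zero_of_le hk (not_le.1 hcon).le)
      have h6 : (4 : ℝ) ^ k = (2 ^ k) ^ 2 := by rw [← pow_mul, mul_comm, pow_mul]; norm_num
      have h8 : (11 / 20 * 2 ^ k) ^ 2 ≤ freq η ^ 2 := by gcongr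
      rw [h6]
      nlinarith
  calc (1 + freq η ^ 2) ^ (-σ / 2) ≤ ((4 : ℝ) ^ k / 4) ^ (-σ / 2) :=
        Real.rpow_le_rpow_of_nonpos (by positivity) h1 (by linarith)
    _ = 2 ^ σ * (2 ^ (-σ)) ^ k := by
        rw [show (4 : ℝ) = 2 ^ (2 : ℝ) by norm_num, ← Real.rpow_natCast, ← Real.rpow_natCast,
          ← Real.rpow_mul (by norm_num), ← Real.rpow_sub (by norm_num),
          ← Real.rpow_mul (by norm_num), ← Real.rpow_mul (by norm_num), ← Real.rpow_add (by norm_num)]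
        congr 1
        ring
    _ ≤ 2 * (2 ^ (-σ)) ^ k := by
        gcongr
        calc (2 : ℝ) ^ σ ≤ 2 ^ (1 : ℝ) := by gcongr; norm_num
          _ = 2 := by norm_num

end Sobolev

/-! ### The product rule for distributions -/

section Leibniz

variable {E : Type*} [NormedAddCommGroup E] [InnerProductSpace ℝ E]

theorem hasTemperateGrowth_fderiv_apply {b : E → ℂ} (hb : b.HasTemperateGrowth) (v : E) :
    (fun x ↦ fderiv ℝ b x v).HasTemperateGrowth := by
  have h : (fderiv ℝ b).HasTemperateGrowth := by
    refine ⟨hb.1.fderiv_right (m := (⊤ : ℕ∞)) (by simp), fun N ↦ ?_⟩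
    obtain ⟨k, C, hC⟩ := hb.2 (N + 1)
    exact ⟨k, C, fun x ↦ by rw [norm_iteratedFDeriv_fderiv]; exact hC x⟩
  exact (ContinuousLinearMap.apply ℝ ℂ v).hasTemperateGrowth.comp h

/-- The product rule for the multiplication of a tempered distribution by a function. -/
theorem smulLeft_lineDeriv {b : E → ℂ} (hb : b.HasTemperateGrowth) (v : E) (w : 𝓢'(E, ℂ)) :
    smulLeftCLM ℂ b (∂_{v} w)
      = ∂_{v} (smulLeftCLM ℂ b w) - smulLeftCLM ℂ (fun x ↦ fderiv ℝ b x v) w := by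
  ext φ
  have h : ∂_{v} (SchwartzMap.smulLeftCLM ℂ b φ) = SchwartzMap.smulLeftCLM ℂ b (∂_{v} φ)
      + SchwartzMap.smulLeftCLM ℂ (fun x ↦ fderiv ℝ b x v) φ := by
    ext x
    have h1 : HasFDerivAt b (fderiv ℝ b x) x := (hb.1.differentiable (by simp) x).hasFDerivAt
    have h2 : fderiv ℝ (fun x ↦ b x • φ x) x = _ := (h1.smul (φ.hasFDerivAt x)).fderiv
    change _ = SchwartzMap.smulLeftCLM ℂ b (∂_{v} φ) x
      + SchwartzMap.smulLeftCLM ℂ (fun x ↦ fderiv ℝ b x v) φ x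
    rw [SchwartzMap.lineDerivOp_apply_eq_fderiv, SchwartzMap.smulLeftCLM_apply hb, h2,
      SchwartzMap.smulLeftCLM_apply_apply hb,
      SchwartzMap.smulLeftCLM_apply_apply (hasTemperateGrowth_fderiv_apply hb v),
      SchwartzMap.lineDerivOp_apply_eq_fderiv]
    simp
  simp only [smulLeftCLM_apply_apply, lineDerivOp_apply_apply, _root_.sub_apply, h, map_neg,
    map_add]
  ring

end Leibniz

/-! ### The paraproduct -/

section Paraproduct

variable {n : ℕ} {χ : ℝ → ℝ} {a : EuclideanSpace ℝ (Fin n) → ℂ}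

/-- The coefficient of `Δ_k w` in the modified paraproduct `T^m_a w`; the low frequency term
`S_{m-1} a · S_{m+1} w` is split into its blocks as well. -/
noncomputable def coeff (χ : ℝ → ℝ) (m : ℕ) (a : EuclideanSpace ℝ (Fin n) → ℂ) (k : ℕ) :
    EuclideanSpace ℝ (Fin n) → ℂ :=
  SFun χ (max ((m : ℤ) - 1) ((k : ℤ) - 3)) a

theorem sum_block (χ : ℝ → ℝ) (K : ℕ) :
    ∑ k ∈ Finset.range (K + 1), Block (n := n) χ k = S χ K := by
  induction K with
  | zero => simp [Block, S]
  | succ K ih =>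
    rw [Finset.sum_range_succ, ih, Block]
    push_cast
    simp

/-- The low frequency term is absorbed by the series, which then runs over all blocks. -/
theorem hasSum_para {m : ℕ} {w : 𝓢'(EuclideanSpace ℝ (Fin n), ℂ)} (h : ParaConverges χ m a w) :
    HasSum (fun k ↦ smulLeftCLM ℂ (coeff χ m a k) (Block χ k w)) (para χ m a w) := by
  have h1 : ∀ k ∈ Finset.range (m + 1 + 1),
      smulLeftCLM ℂ (coeff χ m a k) (Block χ k w)
        = smulLeftCLM ℂ (SFun χ ((m : ℤ) - 1) a) (Block χ k w) := fun k hk ↦ by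
    rw [coeff, max_eq_left]
    have := Finset.mem_range.1 hk
    omega
  have h2 : ∑ k ∈ Finset.range (m + 1 + 1), smulLeftCLM ℂ (coeff χ m a k) (Block χ k w)
      = smulLeftCLM ℂ (SFun χ ((m : ℤ) - 1) a) (S χ ((m : ℤ) + 1) w) := by
    rw [Finset.sum_congr rfl h1, ← map_sum, ← _root_.sum_apply, sum_block]
    norm_cast
  have h3 : ∀ i : ℕ, paraTerm χ a (m + 2 + i) w
      = smulLeftCLM ℂ (coeff χ m a (i + (m + 1 + 1))) (Block χ (i + (m + 1 + 1)) w) := fun i ↦ by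
    rw [paraTerm, coeff, max_eq_right (by push_cast; omega),
      show m + 2 + i = i + (m + 1 + 1) by ring]
  rw [para, ← h2, add_comm, ← hasSum_nat_add_iff (m + 1 + 1)]
  simp_rw [← h3]
  exact Summable.hasSum h

theorem block_block_eq_zero (hχ : IsCutoff χ) {k ν : ℕ} (h : k + 2 ≤ ν ∨ ν + 2 ≤ k)
    (w : 𝓢'(EuclideanSpace ℝ (Fin n), ℂ)) : Block χ k (Block χ ν w) = 0 := by
  have h0 : blockSymbol (n := n) χ ν * blockSymbol χ k = fun _ ↦ 0 := by
    ext η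
    rcases h with h | h
    · rw [Pi.mul_apply, mul_comm, blockSymbol_mul_eq_zero hχ h]
    · rw [Pi.mul_apply, blockSymbol_mul_eq_zero hχ h]
  rw [hχ.block_eq, hχ.block_eq, fourierMultiplierCLM_fourierMultiplierCLM_apply
    (hχ.hasTemperateGrowth_blockSymbol ν) (hχ.hasTemperateGrowth_blockSymbol k), h0]
  simp

theorem block_comm (hχ : IsCutoff χ) (k ν : ℕ) (w : 𝓢'(EuclideanSpace ℝ (Fin n), ℂ)) :
    Block χ k (Block χ ν w) = Block χ ν (Block χ k w) := by
  have hk := hχ.hasTemperateGrowth_blockSymbol (n := n) k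
  have hν := hχ.hasTemperateGrowth_blockSymbol (n := n) ν
  rw [hχ.block_eq, hχ.block_eq, fourierMultiplierCLM_fourierMultiplierCLM_apply hν hk,
    fourierMultiplierCLM_fourierMultiplierCLM_apply hk hν, mul_comm]

theorem block_partialD (hχ : IsCutoff χ) (k : ℕ) (h : Fin n)
    (u : 𝓢'(EuclideanSpace ℝ (Fin n), ℂ)) :
    Block χ k (partialD h u) = partialD h (Block χ k u) := by
  have hk := hχ.hasTemperateGrowth_blockSymbol (n := n) k
  rw [hχ.block_eq, partialD_eq, partialD_eq,
    fourierMultiplierCLM_fourierMultiplierCLM_apply (by fun_prop) hk,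
    fourierMultiplierCLM_fourierMultiplierCLM_apply hk (by fun_prop), mul_comm]

/-- On a spectrally localized distribution only finitely many terms of the paraproduct survive. -/
theorem paraConverges_block (hχ : IsCutoff χ) (m ν : ℕ) (w : 𝓢'(EuclideanSpace ℝ (Fin n), ℂ)) :
    ParaConverges χ m a (Block χ ν w) := by
  refine summable_of_ne_finset_zero (s := Finset.range (ν + 2)) fun i hi ↦ ?_
  have := Finset.mem_range.not.1 hi
  rw [paraTerm, block_block_eq_zero hχ (Or.inr (by omega)), map_zero]

theorem exists_norm_fderiv_SFun_le (hχ : IsCutoff χ) (ha : IsLip a) :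
    ∃ C : ℝ, ∀ (k : ℤ) x, ‖fderiv ℝ (SFun χ k a) x‖ ≤ C := by
  obtain ⟨K, hK⟩ := ha.lipschitz
  exact ⟨_, norm_fderiv_SFun_le hχ ha K.2 (.of_forall fun x ↦ norm_fderiv_le_of_lipschitz ℝ hK)⟩

/-- Convergence of the paraproduct with `∂_h u`, `u ∈ H^σ`, `σ > 0`. The terms are
`∂_h (S_{k-3} a · Δ_k u) - (∂_h S_{k-3} a) · Δ_k u`, and both series converge absolutely in `L²`. -/
theorem paraConverges_partialD (hχ : IsCutoff χ) (ha : IsLip a) {σ : ℝ} (hσ : σ ∈ Set.Ioo (0 : ℝ) 1)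
    {u : 𝓢'(EuclideanSpace ℝ (Fin n), ℂ)}
    {f : Lp ℂ 2 (volume : Measure (EuclideanSpace ℝ (Fin n)))}
    (hf : Lp.toTemperedDistribution f = fourierMultiplierCLM ℂ (besselWeight σ) u)
    (m : ℕ) (h : Fin n) : ParaConverges χ m a (partialD h u) := by
  set v : EuclideanSpace ℝ (Fin n) := EuclideanSpace.single h (1 : ℝ)
  obtain ⟨C₀, hC₀⟩ := exists_norm_SFun_le hχ ha
  obtain ⟨C₁, hC₁⟩ := exists_norm_fderiv_SFun_le hχ ha
  have hC₀0 : 0 ≤ C₀ := (norm_nonneg _).trans (hC₀ 0 0)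
  have hC₁0 : 0 ≤ C₁ := (norm_nonneg _).trans (hC₁ 0 0)
  have hbt : ∀ c, (SFun χ c a).HasTemperateGrowth := hasTemperateGrowth_SFun hχ ha
  choose G hG hGn using exists_lp_block hχ hσ.1.le hσ.2.le hf
  have hr1 : (2 : ℝ) ^ (-σ) < 1 :=
    Real.rpow_lt_one_of_one_lt_of_neg (by norm_num) (by linarith [hσ.1])
  have hgeom : Summable fun i : ℕ ↦ 2 * ((2 : ℝ) ^ (-σ)) ^ (m + 2 + i) * ‖f‖ := by
    simp_rw [pow_add _ (m + 2)]
    exact (((summable_geometric_of_lt_one (by positivity) hr1).mul_left _).mul_left _).mul_right _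
  have key : ∀ (b : ℕ → EuclideanSpace ℝ (Fin n) → ℂ) (_ : ∀ i, (b i).HasTemperateGrowth) (C : ℝ)
      (_ : 0 ≤ C) (_ : ∀ i x, ‖b i x‖ ≤ C),
      Summable fun i ↦ smulLeftCLM ℂ (b i) (Block χ (m + 2 + i) u) := fun b hb C hC0 hC ↦ by
    choose F hF hFn using fun i ↦ exists_lp_smulLeft (hb i) (hC i) (G (m + 2 + i))
    have hs : Summable F := Summable.of_norm_bounded (hgeom.mul_left C) fun i ↦
      (hFn i).trans (by gcongr; exact hGn _)
    have := (Lp.toTemperedDistributionCLM ℂ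
      (volume : Measure (EuclideanSpace ℝ (Fin n))) 2).summable hs
    simpa only [Lp.toTemperedDistributionCLM_apply, hF, hG] using this
  have h1 := key (fun i ↦ SFun χ (((m + 2 + i : ℕ) : ℤ) - 3) a) (fun i ↦ hbt _) C₀ hC₀0
    fun i x ↦ hC₀ _ x
  have h2 := key (fun i x ↦ fderiv ℝ (SFun χ (((m + 2 + i : ℕ) : ℤ) - 3) a) x v)
    (fun i ↦ hasTemperateGrowth_fderiv_apply (hbt _) v) (C₁ * ‖v‖) (by positivity)
    fun i x ↦ (ContinuousLinearMap.le_opNorm _ _).trans (by gcongr; exact hC₁ _ x)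
  have h3 := (LineDeriv.lineDerivOpCLM ℂ 𝓢'(EuclideanSpace ℝ (Fin n), ℂ) v).summable h1
  refine (h3.sub h2).congr fun i ↦ ?_
  rw [paraTerm, block_partialD hχ, partialD, smulLeft_lineDeriv (hbt _)]
  rfl

end Paraproduct

/-! ### The commutator with one block -/

section BlockCommutator

variable {n : ℕ} {χ : ℝ → ℝ} {a : EuclideanSpace ℝ (Fin n) → ℂ}

theorem norm_toLp_commutator_low_le (hχ : IsCutoff χ) {b : EuclideanSpace ℝ (Fin n) → ℂ}
    (hb : b.HasTemperateGrowth) {M K : ℝ} (hM : ∀ x, ‖b x‖ ≤ M) (hK : ∀ x, ‖fderiv ℝ b x‖ ≤ K)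
    (k : ℤ) (j : Fin n) (φ : 𝓢(EuclideanSpace ℝ (Fin n), ℂ)) :
    ‖(SchwartzMap.fourierMultiplierCLM ℂ (lowSymbol χ k)
        (SchwartzMap.smulLeftCLM ℂ b (∂_{EuclideanSpace.single j (1 : ℝ)} φ))
      - SchwartzMap.smulLeftCLM ℂ b (SchwartzMap.fourierMultiplierCLM ℂ (lowSymbol χ k)
        (∂_{EuclideanSpace.single j (1 : ℝ)} φ))).toLp 2‖
      ≤ K * (∫ y, weight (hχ.kernelSchwartz (n := n) 0) y) * ‖φ.toLp 2‖ := by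
  have hK0 : 0 ≤ K := (norm_nonneg _).trans (hK 0)
  have hw : 0 ≤ ∫ y, weight (hχ.kernelSchwartz (n := n) 0) y :=
    integral_nonneg fun y ↦ weight_nonneg _ y
  rcases lt_or_ge k 0 with hk | hk
  · have h0 : lowSymbol (n := n) χ k = fun _ ↦ 0 := funext (lowSymbol_of_neg hk)
    have h1 : ∀ ψ : 𝓢(EuclideanSpace ℝ (Fin n), ℂ),
        SchwartzMap.fourierMultiplierCLM ℂ (lowSymbol χ k) ψ = 0 := fun ψ ↦ by
      rw [h0, SchwartzMap.fourierMultiplierCLM_const, zero_smul, _root_.zero_apply]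
    rw [h1, h1, map_zero, sub_zero]
    have h2 : (0 : 𝓢(EuclideanSpace ℝ (Fin n), ℂ)).toLp 2
        (volume : Measure (EuclideanSpace ℝ (Fin n))) = 0 :=
      map_zero (SchwartzMap.toLpCLM ℂ (E := EuclideanSpace ℝ (Fin n)) ℂ 2 volume)
    rw [h2, norm_zero]
    positivity
  · lift k to ℕ using hk
    rw [← hχ.integral_weight_kernelSchwartz k]
    refine norm_toLp_le_of_convolution_bound (weight_nonneg _) (integrable_weight _)
      (continuous_weight _) hK0 _ _ fun x ↦ ?_
    have h := norm_commutator_lineDeriv_apply_le (hχ.hasTemperateGrowth_lowSymbol k) hb hM hK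
      (hχ.kernelSchwartz k) φ (fun η ↦ ?_) (EuclideanSpace.single j (1 : ℝ)) x
    · simpa [weight] using h
    · rw [IsCutoff.kernelSchwartz, FourierTransform.fourier_fourierInv_eq,
        IsCutoff.lowSchwartz_apply]

/-- The commutator of `Δ_ν` with multiplication by a Lipschitz function gains one derivative,
uniformly in `ν`. -/
theorem norm_toLp_commutator_block_le (hχ : IsCutoff χ) {b : EuclideanSpace ℝ (Fin n) → ℂ}
    (hb : b.HasTemperateGrowth) {M K : ℝ} (hM : ∀ x, ‖b x‖ ≤ M) (hK : ∀ x, ‖fderiv ℝ b x‖ ≤ K)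
    (ν : ℕ) (j : Fin n) (φ : 𝓢(EuclideanSpace ℝ (Fin n), ℂ)) :
    ‖(SchwartzMap.fourierMultiplierCLM ℂ (blockSymbol χ ν)
        (SchwartzMap.smulLeftCLM ℂ b (∂_{EuclideanSpace.single j (1 : ℝ)} φ))
      - SchwartzMap.smulLeftCLM ℂ b (SchwartzMap.fourierMultiplierCLM ℂ (blockSymbol χ ν)
        (∂_{EuclideanSpace.single j (1 : ℝ)} φ))).toLp 2‖
      ≤ 2 * K * (∫ y, weight (hχ.kernelSchwartz (n := n) 0) y) * ‖φ.toLp 2‖ := by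
  have hsymb : blockSymbol (n := n) χ ν = lowSymbol χ ν - lowSymbol χ ((ν : ℤ) - 1) := rfl
  have h : ∀ ψ : 𝓢(EuclideanSpace ℝ (Fin n), ℂ),
      SchwartzMap.fourierMultiplierCLM ℂ (blockSymbol χ ν) ψ
        = SchwartzMap.fourierMultiplierCLM ℂ (lowSymbol χ ν) ψ
          - SchwartzMap.fourierMultiplierCLM ℂ (lowSymbol χ ((ν : ℤ) - 1)) ψ := fun ψ ↦ by
    simp only [SchwartzMap.fourierMultiplierCLM_apply]
    rw [hsymb, SchwartzMap.smulLeftCLM_sub (hχ.hasTemperateGrowth_lowSymbol _)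
      (hχ.hasTemperateGrowth_lowSymbol _)]
    exact map_sub (fourierInvCLM ℂ 𝓢(EuclideanSpace ℝ (Fin n), ℂ)) _ _
  set v : EuclideanSpace ℝ (Fin n) := EuclideanSpace.single j (1 : ℝ)
  have hsplit : ∀ A B C D : 𝓢(EuclideanSpace ℝ (Fin n), ℂ), A - B - (C - D) = (A - C) - (B - D) :=
    fun A B C D ↦ by abel
  have hsub : ∀ A B : 𝓢(EuclideanSpace ℝ (Fin n), ℂ),
      (A - B).toLp 2 (volume : Measure (EuclideanSpace ℝ (Fin n)))
        = A.toLp 2 volume - B.toLp 2 volume :=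
    map_sub (SchwartzMap.toLpCLM ℂ (E := EuclideanSpace ℝ (Fin n)) ℂ 2 volume)
  rw [h, h, map_sub, hsplit, hsub]
  refine (norm_sub_le _ _).trans ((add_le_add (norm_toLp_commutator_low_le hχ hb hM hK _ j φ)
    (norm_toLp_commutator_low_le hχ hb hM hK _ j φ)).trans (le_of_eq (by ring)))

/-- The transpose of `Δ_ν` is `Δ_ν`. -/
theorem block_apply (hχ : IsCutoff χ) (ν : ℕ) (w : 𝓢'(EuclideanSpace ℝ (Fin n), ℂ))
    (φ : 𝓢(EuclideanSpace ℝ (Fin n), ℂ)) :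
    Block χ ν w φ = w (SchwartzMap.fourierMultiplierCLM ℂ (blockSymbol χ ν) φ) := by
  rw [hχ.block_eq, fourierMultiplierCLM_apply,
    ← fourier_smulLeft_fourierInv (hχ.hasTemperateGrowth_blockSymbol ν) (blockSymbol_even ν)]
  rfl

/-- The contribution of `Δ_k w` to `∂_j [Δ_ν, T^m_a] w`. -/
noncomputable def commTerm (χ : ℝ → ℝ) (ν m : ℕ) (a : EuclideanSpace ℝ (Fin n) → ℂ) (j : Fin n)
    (w : 𝓢'(EuclideanSpace ℝ (Fin n), ℂ)) (k : ℕ) : 𝓢'(EuclideanSpace ℝ (Fin n), ℂ) :=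
  partialD j (Block χ ν (smulLeftCLM ℂ (coeff χ m a k) (Block χ k w))
    - smulLeftCLM ℂ (coeff χ m a k) (Block χ k (Block χ ν w)))

theorem hasSum_commTerm {ν m : ℕ} {w : 𝓢'(EuclideanSpace ℝ (Fin n), ℂ)}
    (h : ParaConverges χ m a w) (h' : ParaConverges χ m a (Block χ ν w)) (j : Fin n) :
    HasSum (commTerm χ ν m a j w) (partialD j (comm χ ν m a w)) :=
  (LineDeriv.lineDerivOpCLM ℂ 𝓢'(EuclideanSpace ℝ (Fin n), ℂ)
    (EuclideanSpace.single j (1 : ℝ))).hasSum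
      (((Block χ ν).hasSum (hasSum_para h)).sub (hasSum_para h'))

/-- The products `S_c a · Δ_k w`, `c = max (m - 1) (k - 3)`, are localized at frequencies of size
`2^k` for `k ≥ m + 2`, and at frequencies of size `O(2^m)` otherwise. -/
theorem commTerm_eq_zero (hχ : IsCutoff χ) (ha : IsLip a) {ν m k : ℕ}
    (h : k + m + 5 ≤ ν ∨ ν + m + 5 ≤ k) (j : Fin n) (w : 𝓢'(EuclideanSpace ℝ (Fin n), ℂ)) :
    commTerm χ ν m a j w k = 0 := by
  have h1 : Block χ k (Block χ ν w) = 0 := block_block_eq_zero hχ (by omega) w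
  have h2 : Block χ ν (smulLeftCLM ℂ (coeff χ m a k) (Block χ k w)) = 0 := by
    ext φ
    have h3 := smulLeft_fourierInv_SFun_mul_eq_zero hχ ha _ (blockSymbol_sub_eq_zero hχ h) (𝓕⁻ φ)
    rw [hχ.block_eq, hχ.block_eq, fourierMultiplierCLM_apply_apply, smulLeftCLM_apply_apply,
      fourierMultiplierCLM_apply_apply, coeff, h3]
    exact (congrArg w (map_zero (fourierCLM ℂ 𝓢(EuclideanSpace ℝ (Fin n), ℂ)))).trans (map_zero w)
  rw [commTerm, h1, h2, map_zero, sub_zero, partialD, LineDeriv.lineDerivOp_zero]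

/-- Since `Δ_k` and `Δ_ν` commute, the term is the transpose of `[Δ_ν, b] ∂_j` applied to `Δ_k w`;
the derivative falls on the test function, so that no derivative of `Δ_k w` is needed. -/
theorem norm_commTerm_apply_le (hχ : IsCutoff χ) (ha : IsLip a) {K : ℝ}
    (hK : ∀ (k : ℤ) x, ‖fderiv ℝ (SFun χ k a) x‖ ≤ K) (ν m k : ℕ) (j : Fin n)
    {w : 𝓢'(EuclideanSpace ℝ (Fin n), ℂ)}
    {F : Lp ℂ 2 (volume : Measure (EuclideanSpace ℝ (Fin n)))}
    (hF : Lp.toTemperedDistribution F = Block χ k w) (φ : 𝓢(EuclideanSpace ℝ (Fin n), ℂ)) :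
    ‖commTerm χ ν m a j w k φ‖
      ≤ ‖F‖ * (2 * K * ∫ y, weight (hχ.kernelSchwartz (n := n) 0) y) * ‖φ.toLp 2‖ := by
  obtain ⟨M, hM⟩ := exists_norm_SFun_le hχ ha
  have h : commTerm χ ν m a j w k φ = Block χ k w
      (SchwartzMap.fourierMultiplierCLM ℂ (blockSymbol χ ν)
        (SchwartzMap.smulLeftCLM ℂ (coeff χ m a k) (∂_{EuclideanSpace.single j (1 : ℝ)} φ))
      - SchwartzMap.smulLeftCLM ℂ (coeff χ m a k)
        (SchwartzMap.fourierMultiplierCLM ℂ (blockSymbol χ ν)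
          (∂_{EuclideanSpace.single j (1 : ℝ)} φ))) := by
    rw [commTerm, block_comm hχ, partialD, lineDerivOp_apply_apply, _root_.sub_apply, block_apply hχ,
      smulLeftCLM_apply_apply, smulLeftCLM_apply_apply, block_apply hχ ν (Block χ k w), map_sub]
    simp only [map_neg]
    ring
  rw [h, ← hF, mul_assoc]
  refine (norm_toTemperedDistribution_apply_le _ _).trans ?_
  gcongr
  exact norm_toLp_commutator_block_le hχ (hasTemperateGrowth_SFun hχ ha _) (hM _) (hK _) ν j φ

/-- The estimate of one block of the commutator: only the blocks `Δ_k w` with `|k - ν| ≤ m + 4`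
contribute to it. -/
theorem l2Norm_comm_le (hχ : IsCutoff χ) (ha : IsLip a) {K : ℝ}
    (hK : ∀ (k : ℤ) x, ‖fderiv ℝ (SFun χ k a) x‖ ≤ K) (ν m : ℕ) (j : Fin n)
    {w : 𝓢'(EuclideanSpace ℝ (Fin n), ℂ)} (hw : ParaConverges χ m a w)
    {F : ℕ → Lp ℂ 2 (volume : Measure (EuclideanSpace ℝ (Fin n)))}
    (hF : ∀ k, Lp.toTemperedDistribution (F k) = Block χ k w) :
    l2Norm (partialD j (comm χ ν m a w)) ≤ ENNReal.ofReal
      ((2 * K * ∫ y, weight (hχ.kernelSchwartz (n := n) 0) y)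
        * ∑ k ∈ Finset.Icc (ν - (m + 4)) (ν + (m + 4)), ‖F k‖) := by
  have hK0 : 0 ≤ K := (norm_nonneg _).trans (hK 0 0)
  have hw0 : 0 ≤ ∫ y, weight (hχ.kernelSchwartz (n := n) 0) y :=
    integral_nonneg fun y ↦ weight_nonneg _ y
  have h1 : partialD j (comm χ ν m a w)
      = ∑ k ∈ Finset.Icc (ν - (m + 4)) (ν + (m + 4)), commTerm χ ν m a j w k := by
    refine (hasSum_commTerm hw (paraConverges_block hχ m ν w) j).unique
      (hasSum_sum_of_ne_finset_zero fun k hk ↦ commTerm_eq_zero hχ ha ?_ j w)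
    rw [Finset.mem_Icc] at hk
    omega
  refine l2Norm_le_of_bound _ _ (mul_nonneg (by positivity)
    (Finset.sum_nonneg fun _ _ ↦ norm_nonneg _)) fun φ ↦ ?_
  rw [h1, _root_.sum_apply, Finset.mul_sum, Finset.sum_mul]
  refine norm_sum_le_of_le _ fun k _ ↦ ?_
  refine (norm_commTerm_apply_le hχ ha hK ν m k j (hF k) φ).trans (le_of_eq (by ring))

end BlockCommutator

/-! ### Summation over the blocks -/

section Summation

theorem ennreal_sq_sum_le_card_mul_sum_sq (s : Finset ℕ) (N : ℕ → ℝ≥0∞) :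
    (∑ k ∈ s, N k) ^ 2 ≤ s.card * ∑ k ∈ s, N k ^ 2 := by
  have h := ENNReal.inner_le_Lp_mul_Lq s (fun _ ↦ 1) N Real.HolderConjugate.two_two
  simp only [one_mul, Finset.sum_const, nsmul_eq_mul, ENNReal.rpow_two, one_pow, mul_one] at h
  have hs : ∀ x : ℝ≥0∞, (x ^ (1 / 2 : ℝ)) ^ 2 = x := fun x ↦ by
    rw [← ENNReal.rpow_natCast, ← ENNReal.rpow_mul]; norm_num
  refine (pow_le_pow_left' h 2).trans (le_of_eq ?_)
  rw [mul_pow, hs, hs]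

/-- Each index `k` lies in at most `2P + 1` of the windows `|k - ν| ≤ P`. -/
theorem tsum_sq_sum_Icc_le (N : ℕ → ℝ≥0∞) (P : ℕ) :
    ∑' ν, (∑ k ∈ Finset.Icc (ν - P) (ν + P), N k) ^ 2 ≤ (2 * P + 1) ^ 2 * ∑' k, N k ^ 2 := by
  have hcard : ∀ ν, ((Finset.Icc (ν - P) (ν + P)).card : ℝ≥0∞) ≤ 2 * P + 1 := fun ν ↦ by
    rw [Nat.card_Icc]
    norm_cast
    omega
  calc ∑' ν, (∑ k ∈ Finset.Icc (ν - P) (ν + P), N k) ^ 2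
      ≤ ∑' ν, (2 * P + 1) * ∑ k ∈ Finset.Icc (ν - P) (ν + P), N k ^ 2 :=
        ENNReal.tsum_le_tsum fun ν ↦ (ennreal_sq_sum_le_card_mul_sum_sq _ _).trans
          (mul_le_mul_left (hcard ν) _)
    _ = (2 * P + 1) * ∑' ν, ∑ k ∈ Finset.Icc (ν - P) (ν + P), N k ^ 2 := ENNReal.tsum_mul_left
    _ = (2 * P + 1) * ∑' ν, ∑' k, if k ∈ Finset.Icc (ν - P) (ν + P) then N k ^ 2 else 0 := by
        congr 2
        ext ν
        rw [tsum_eq_sum (s := Finset.Icc (ν - P) (ν + P)) fun k hk ↦ if_neg hk]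
        exact Finset.sum_congr rfl fun k hk ↦ (if_pos hk).symm
    _ = (2 * P + 1) * ∑' k, ∑' ν, if ν ∈ Finset.Icc (k - P) (k + P) then N k ^ 2 else 0 := by
        rw [ENNReal.tsum_comm]
        congr! 6 with k ν
        simp only [Finset.mem_Icc]
        omega
    _ ≤ (2 * P + 1) * ∑' k, (2 * P + 1) * N k ^ 2 := by
        gcongr with k
        rw [tsum_eq_sum (s := Finset.Icc (k - P) (k + P)) fun ν hν ↦ if_neg hν,
          Finset.sum_congr rfl fun ν hν ↦ if_pos hν, Finset.sum_const, nsmul_eq_mul]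
        exact mul_le_mul_left (hcard k) _
    _ = _ := by rw [ENNReal.tsum_mul_left, sq, mul_assoc]

end Summation

section Conclusion

variable {n : ℕ} {χ : ℝ → ℝ} {a : EuclideanSpace ℝ (Fin n) → ℂ}

/-- The `ℓ²` sum of the commutators, for `f = (1 + |D|²)^{(1-s)/2} u`. -/
theorem tsum_comm_le (hχ : IsCutoff χ) (ha : IsLip a) {K : ℝ}
    (hK : ∀ (k : ℤ) x, ‖fderiv ℝ (SFun χ k a) x‖ ≤ K) {s : ℝ} (hs : s ∈ Set.Ioo (0 : ℝ) 1) (m : ℕ)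
    {u : 𝓢'(EuclideanSpace ℝ (Fin n), ℂ)} {f : Lp ℂ 2 (volume : Measure (EuclideanSpace ℝ (Fin n)))}
    (hf : Lp.toTemperedDistribution f = fourierMultiplierCLM ℂ (besselWeight (1 - s)) u)
    (j h : Fin n) :
    ∑' ν : ℕ, (2 : ℝ≥0∞) ^ (-(2 * (ν : ℝ) * s)) *
        l2Norm (partialD j (comm χ ν m a (partialD h u))) ^ 2
      ≤ (ENNReal.ofReal (6 * K * (∫ y, weight (hχ.kernelSchwartz (n := n) 0) y) * 2 ^ (m + 4))
          * (2 * (m + 4 : ℕ) + 1) * ‖f‖ₑ) ^ 2 := by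
  set A : ℝ := ∫ y, weight (hχ.kernelSchwartz (n := n) 0) y
  have hA : 0 ≤ A := integral_nonneg fun y ↦ weight_nonneg _ y
  have hK0 : 0 ≤ K := (norm_nonneg _).trans (hK 0 0)
  have hpara : ParaConverges χ m a (partialD h u) :=
    paraConverges_partialD hχ ha ⟨by linarith [hs.2], by linarith [hs.1]⟩ hf m h
  choose F hF hFn using exists_lp_block_partialD hχ hs hf h
  set D : ℝ := 6 * K * A * 2 ^ (m + 4) with hD
  have hD0 : 0 ≤ D := by positivity
  have hblock : ∀ ν : ℕ, l2Norm (partialD j (comm χ ν m a (partialD h u)))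
      ≤ ENNReal.ofReal (2 ^ (ν * s)) * (ENNReal.ofReal D
        * ∑ k ∈ Finset.Icc (ν - (m + 4)) (ν + (m + 4)), blockNorm χ f k) := fun ν ↦ by
    refine (l2Norm_comm_le hχ ha hK ν m j hpara hF).trans ?_
    have h1 : ∀ k ∈ Finset.Icc (ν - (m + 4)) (ν + (m + 4)),
        ‖F k‖ ≤ 3 * (2 ^ (ν * s) * 2 ^ (m + 4)) * (blockNorm χ f k).toReal := fun k hk ↦ by
      refine (hFn k).trans ?_
      gcongr
      have h2 : (k : ℝ) ≤ ν + (m + 4 : ℕ) := by exact_mod_cast (Finset.mem_Icc.1 hk).2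
      rw [← Real.rpow_natCast 2 (m + 4), ← Real.rpow_add (by norm_num)]
      refine Real.rpow_le_rpow_of_exponent_le (by norm_num) ?_
      nlinarith [hs.1, hs.2, mul_nonneg (Nat.cast_nonneg (α := ℝ) (m + 4)) (sub_nonneg.2 hs.2.le)]
    have h3 : ∑ k ∈ Finset.Icc (ν - (m + 4)) (ν + (m + 4)), blockNorm χ f k
        = ENNReal.ofReal (∑ k ∈ Finset.Icc (ν - (m + 4)) (ν + (m + 4)),
          (blockNorm χ f k).toReal) := by
      rw [ENNReal.ofReal_sum_of_nonneg fun _ _ ↦ ENNReal.toReal_nonneg]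
      exact Finset.sum_congr rfl fun k _ ↦
        (ENNReal.ofReal_toReal ((blockNorm_le hχ f k).trans_lt enorm_lt_top).ne).symm
    rw [h3, ← ENNReal.ofReal_mul hD0, ← ENNReal.ofReal_mul (by positivity)]
    refine ENNReal.ofReal_le_ofReal ?_
    calc 2 * K * A * ∑ k ∈ Finset.Icc (ν - (m + 4)) (ν + (m + 4)), ‖F k‖
        ≤ 2 * K * A * ∑ k ∈ Finset.Icc (ν - (m + 4)) (ν + (m + 4)),
          3 * (2 ^ (ν * s) * 2 ^ (m + 4)) * (blockNorm χ f k).toReal := by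
          gcongr with k hk
          exact h1 k hk
      _ = _ := by rw [← Finset.mul_sum, hD]; ring
  -- the weight `2^{-2νs}` absorbs the growth of the blocks of `∂_h u`
  have hcancel : ∀ ν : ℕ,
      (2 : ℝ≥0∞) ^ (-(2 * (ν : ℝ) * s)) * ENNReal.ofReal (2 ^ (ν * s)) ^ 2 = 1 := fun ν ↦ by
    rw [← ENNReal.ofReal_rpow_of_pos (by norm_num), ← ENNReal.rpow_natCast, ← ENNReal.rpow_mul,
      ENNReal.ofReal_ofNat, ← ENNReal.rpow_add _ _ (by norm_num) (by norm_num)]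
    simp only [Nat.cast_ofNat]
    ring_nf
    simp
  calc _ ≤ ∑' ν : ℕ, ENNReal.ofReal D ^ 2
          * (∑ k ∈ Finset.Icc (ν - (m + 4)) (ν + (m + 4)), blockNorm χ f k) ^ 2 := by
        refine ENNReal.tsum_le_tsum fun ν ↦ ?_
        refine (mul_le_mul_right (pow_le_pow_left' (hblock ν) 2) _).trans (le_of_eq ?_)
        rw [mul_pow, ← mul_assoc, hcancel, one_mul, mul_pow]
    _ = ENNReal.ofReal D ^ 2
          * ∑' ν : ℕ, (∑ k ∈ Finset.Icc (ν - (m + 4)) (ν + (m + 4)), blockNorm χ f k) ^ 2 :=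
        ENNReal.tsum_mul_left
    _ ≤ ENNReal.ofReal D ^ 2 * ((2 * (m + 4 : ℕ) + 1) ^ 2 * ‖f‖ₑ ^ 2) := by
        gcongr
        exact (tsum_sq_sum_Icc_le _ _).trans (mul_le_mul_right (tsum_blockNorm_sq_le hχ f) _)
    _ = _ := by ring

end Conclusion

end LittlewoodPaley

theorem proposition3p7 {n : ℕ} (χ : ℝ → ℝ) (hχ : LittlewoodPaley.IsCutoff χ) (m : ℕ) (s : ℝ)
    (hs : s ∈ Set.Ioo (0 : ℝ) 1) :
    ∃ C : ℝ≥0, ∀ (a : EuclideanSpace ℝ (Fin n) → ℂ) (_ : LittlewoodPaley.IsLip a)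
      (u : 𝓢'(EuclideanSpace ℝ (Fin n), ℂ)) (_ : MemSobolev (1 - s) 2 u) (j h : Fin n),
      LittlewoodPaley.ParaConverges χ m a (LittlewoodPaley.partialD h u) ∧
      (∀ ν : ℕ, LittlewoodPaley.ParaConverges χ m a
        (LittlewoodPaley.Block χ ν (LittlewoodPaley.partialD h u))) ∧
      (∑' ν : ℕ, (2 : ℝ≥0∞) ^ (-(2 * (ν : ℝ) * s)) *
        LittlewoodPaley.l2Norm (LittlewoodPaley.partialD j
          (LittlewoodPaley.comm χ ν m a (LittlewoodPaley.partialD h u))) ^ 2) ^ (1 / 2 : ℝ)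
      ≤ C * LittlewoodPaley.lipNorm a * LittlewoodPaley.sobolevNorm (1 - s) u := by
  set A : ℝ := ∫ y, LittlewoodPaley.weight (hχ.kernelSchwartz (n := n) 0) y with hA
  have hA0 : 0 ≤ A := integral_nonneg fun y ↦ LittlewoodPaley.weight_nonneg _ y
  refine ⟨(6 * A ^ 2 * 2 ^ (m + 4) * (2 * (m + 4 : ℕ) + 1)).toNNReal, fun a ha u hu j h ↦ ?_⟩
  have hσ : 1 - s ∈ Set.Ioo (0 : ℝ) 1 := ⟨by linarith [hs.2], by linarith [hs.1]⟩
  obtain ⟨f, hf⟩ := LittlewoodPaley.exists_lp_of_memSobolev hσ.1.le hu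
  refine ⟨LittlewoodPaley.paraConverges_partialD hχ ha hσ hf m h,
    fun ν ↦ LittlewoodPaley.paraConverges_block hχ m ν _, ?_⟩
  have hu_norm : LittlewoodPaley.sobolevNorm (1 - s) u = ‖f‖ₑ := by
    rw [← LittlewoodPaley.l2Norm_toTemperedDistribution, hf]
    rfl
  set L : ℝ := (eLpNorm (fderiv ℝ a) ∞ volume).toReal with hL
  have hfin : eLpNorm (fderiv ℝ a) ∞ volume ≠ ∞ := by
    obtain ⟨K, hK⟩ := ha.lipschitz
    exact (eLpNorm_le_of_ae_bound (C := (K : ℝ))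
      (.of_forall fun x ↦ norm_fderiv_le_of_lipschitz ℝ hK)).trans_lt (by simp) |>.ne
  have hae : ∀ᵐ x, ‖fderiv ℝ a x‖ ≤ L := by
    filter_upwards [ae_le_eLpNormEssSup (f := fderiv ℝ a) (μ := volume)] with x hx
    rw [← eLpNorm_exponent_top] at hx
    rw [hL, ← toReal_enorm]
    exact ENNReal.toReal_mono hfin hx
  have hLa : ENNReal.ofReal L ≤ LittlewoodPaley.lipNorm a := by
    rw [hL, ENNReal.ofReal_toReal hfin]
    exact le_add_self
  have hsum := LittlewoodPaley.tsum_comm_le hχ ha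
    (LittlewoodPaley.norm_fderiv_SFun_le hχ ha ENNReal.toReal_nonneg hae) hs m hf j h
  refine (ENNReal.rpow_le_rpow hsum (by norm_num)).trans ?_
  rw [← ENNReal.rpow_natCast, ← ENNReal.rpow_mul, hu_norm]
  rw [show ((2 : ℕ) : ℝ) * (1 / 2) = 1 by norm_num, ENNReal.rpow_one]
  refine mul_le_mul_left ?_ _
  have hcast : (2 * (m + 4 : ℕ) + 1 : ℝ≥0∞) = ENNReal.ofReal (2 * (m + 4 : ℕ) + 1) := by
    rw [ENNReal.ofReal_add (by positivity) zero_le_one, ENNReal.ofReal_mul zero_le_two,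
      ENNReal.ofReal_natCast, ENNReal.ofReal_ofNat, ENNReal.ofReal_one]
  refine le_trans (le_of_eq ?_) (mul_le_mul_right hLa _)
  rw [hcast, ← ENNReal.ofReal_mul (by positivity)]
  change _ = ENNReal.ofReal _ * _
  rw [← ENNReal.ofReal_mul (by positivity)]
  congr 1
  ring
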